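/- Let $V:\mathbb R\to\mathbb R$ be even and $C^2$ with $1/c\le V''\le c$ for some $c>1$, and suppose that the probability density $\rho=\kappa^{-1}e^{-V}$, $\kappa=\int_{\mathbb R}e^{-V}$, satisfies $\int x^2\rho(x)\,dx=1$. Let $(S_k)_{k\ge0}$ under $\mathbb P_x$ be the random walk started at $x$ with i.i.d. increments of density $\rho$. For $a\ge 0$ and $n\ge1$ let $f^a_n(x,y)$ be the density at $y$ of $S_n$ on the event $\{S_1>a,\dots,S_{n-1}>a\}$ under $\mathbb P_x$, i.e. $$f^a_n(x,y)=\lim_{\varepsilon\downarrow0}\frac1{2\varepsilon}\,\mathbb P_x\big[S_1>a,\dots,S_{n-1}>a,\ S_n\in[y-\varepsilon,y+\varepsilon]\big],$$ and put $f_n=f_n^0(0,0)$. The critical value $\beta_c$ of the standard wetting model is defined by $e^{-\beta_c}=\sum_{n\ge1}f_n$. For $a>0$ and $\lambda\ge 0$ let $b^a_\lambda(x,y)=\sum_{n\ge1}e^{-\lambda n}f^a_n(x,y)$ for $x,y\in[0,a]$, and let $\delta_a(\lambda)$ be the Perron (largest) eigenvalue of the integral operator on $L^2([0,a])$ with kernel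 $b^a_\lambda$. The critical value of the strip wetting model with constant pinning on the strip $[0,a]$ is $\beta_c(a)=-\log\delta_a(0)$. These quantities are well defined: $\sum_n f_n<\infty$, and for every $a>0$ the series $\sum_n f_n^a(x,y)$ converges for all $x,y\in[0,a]$, the kernel $b^a_0$ is square integrable on $[0,a]^2$, and $\delta_a(0)$ is the largest eigenvalue, is positive, and has an eigenfunction that is continuous and strictly positive on $[0,a]$. Moreover: 1. There are constants $C,D>0$ such that for all sufficiently small $a>0$ $$D a^2\le \log a+\beta_c(a)-\beta_c\le C a .$$ 2. The constant pinning functions $\varphi_a\equiv\beta_c(a)$ satisfy Condition (A): there are $a_0>0$ and $C>0$ such that $-C\le \frac1a\log\int_0^a e^{\varphi_a(x)-\beta_c}\,dx\le C$ for all $0<a<a_0$. 3. $a\,e^{\beta_c(a)}\to e^{\beta_c}$ as $a\downarrow0$. -/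

import Mathlib

open MeasureTheory Set Filter Topology

noncomputable section

/-- The data of the random walk: an even potential `V` of class `C²` on the line, with `V''`
bounded between `1/c` and `c` for some `c > 1`, normalised so that the probability density
`e^{-V} / ∫ e^{-V}` has second moment `1`. -/
structure WalkPotential where
  /-- the potential -/
  V : ℝ → ℝ
  contDiff : ContDiff ℝ 2 V
  even : ∀ x, V (-x) = V x
  convex : ∃ c : ℝ, 1 < c ∧ ∀ x, 1 / c ≤ deriv (deriv V) x ∧ deriv (deriv V) x ≤ c
  second_moment : ∫ x, x ^ 2 * (Real.exp (-V x) / ∫ t, Real.exp (-V t)) = 1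

namespace WalkPotential

variable (P : WalkPotential)

/-- The step density `ρ = e^{-V} / κ`, with `κ = ∫ e^{-V}`. -/
def density (x : ℝ) : ℝ := Real.exp (-P.V x) / ∫ t, Real.exp (-P.V t)

/-- The law of one step of the walk. -/
def stepLaw : Measure ℝ := volume.withDensity fun x => ENNReal.ofReal (P.density x)

theorem partition_ne_zero : (∫ t, Real.exp (-P.V t)) ≠ 0 := by
  intro h
  have := P.second_moment
  simp [h] at this

theorem integrable_exp : Integrable fun t => Real.exp (-P.V t) := by
  by_contra h
  exact P.partition_ne_zero (integral_undef h)

theorem partition_pos : 0 < ∫ t, Real.exp (-P.V t) :=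
  lt_of_le_of_ne (integral_nonneg fun _ => (Real.exp_pos _).le) P.partition_ne_zero.symm

theorem density_pos (x : ℝ) : 0 < P.density x := div_pos (Real.exp_pos _) P.partition_pos

theorem continuous_density : Continuous P.density :=
  (Real.continuous_exp.comp P.contDiff.continuous.neg).div_const _

theorem integrable_density : Integrable P.density := P.integrable_exp.div_const _

theorem integral_density : ∫ x, P.density x = 1 := by
  unfold density
  rw [integral_div, div_self P.partition_ne_zero]

instance : IsProbabilityMeasure P.stepLaw := by
  constructor
  rw [stepLaw, withDensity_apply _ MeasurableSet.univ, Measure.restrict_univ,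
    ← ofReal_integral_eq_lintegral_ofReal P.integrable_density
      (Eventually.of_forall fun x => (P.density_pos x).le), P.integral_density, ENNReal.ofReal_one]

/-- The law of the sequence of increments: independent, each with law `stepLaw`. -/
def incrementLaw : Measure (ℕ → ℝ) := Measure.infinitePi fun _ => P.stepLaw

instance : IsProbabilityMeasure P.incrementLaw := by unfold incrementLaw; infer_instance

/-- The walk `S` started at `x` with increments `ξ 0, ξ 1, …`; under `incrementLaw` its law is
`ℙ_x`. -/
def walk (x : ℝ) (ξ : ℕ → ℝ) (n : ℕ) : ℝ := x + ∑ i ∈ Finset.range n, ξ i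

/-- The probability `ℙ_x [S_1 > a, …, S_{n-1} > a, S_n ∈ B]`. -/
def excursionProb (a : ℝ) (n : ℕ) (x : ℝ) (B : Set ℝ) : ℝ :=
  P.incrementLaw.real {ξ | (∀ k, 1 ≤ k → k < n → a < walk x ξ k) ∧ walk x ξ n ∈ B}

/-- The excursion kernel density `f_n^a(x, y)`, for `n ≥ 1`: the density at `y` of `S_n` under
`ℙ_x` on the event `S_1 > a, …, S_{n-1} > a`, that is, the limit as `ε ↓ 0` of
`(2ε)⁻¹ ℙ_x [S_1 > a, …, S_{n-1} > a, S_n ∈ [y - ε, y + ε]]`. -/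
def excursionDensity (a : ℝ) (n : ℕ) (x y : ℝ) : ℝ :=
  limUnder (𝓝[>] (0 : ℝ)) fun ε => (1 / (2 * ε)) * P.excursionProb a n x (Icc (y - ε) (y + ε))

theorem density_le (x : ℝ) : P.density x ≤ P.density 0 := by
  have hV : P.V 0 ≤ P.V x := by
    obtain ⟨c, hc, h⟩ := P.convex
    have hd : Differentiable ℝ P.V := P.contDiff.differentiable (by norm_num)
    have hd2 : Differentiable ℝ (deriv P.V) := by
      have := (contDiff_succ_iff_deriv (n := 1) (f := P.V)).1 (by simpa [one_add_one_eq_two] using P.contDiff)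
      exact this.2.2.differentiable (by norm_num)
    have hconv : ConvexOn ℝ univ P.V := by
      apply convexOn_univ_of_deriv2_nonneg hd hd2
      intro x
      have : 0 < 1 / c := by positivity
      simpa using this.le.trans (h x).1
    have := hconv.2 (mem_univ x) (mem_univ (-x)) (show (0 : ℝ) ≤ 1 / 2 by norm_num)
      (show (0 : ℝ) ≤ 1 / 2 by norm_num) (by norm_num)
    simp only [smul_eq_mul, P.even] at this
    ring_nf at this
    simpa using this
  exact div_le_div_of_nonneg_right (Real.exp_le_exp.2 (by linarith)) P.partition_pos.le

theorem measurable_walk (x : ℝ) (n : ℕ) : Measurable fun ξ => walk x ξ n := by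
  unfold walk; fun_prop

theorem measurableSet_stay (a x : ℝ) (n : ℕ) :
    MeasurableSet {ξ : ℕ → ℝ | ∀ k, 1 ≤ k → k < n + 1 → a < walk x ξ k} := by
  simp only [ofPred_forall]
  exact MeasurableSet.iInter fun k => MeasurableSet.iInter fun _ => MeasurableSet.iInter fun _ =>
    measurableSet_lt measurable_const (measurable_walk x k)

theorem stepLaw_real_Icc (u v : ℝ) : P.stepLaw.real (Icc u v) = ∫ t in Icc u v, P.density t := by
  rw [measureReal_def, stepLaw, withDensity_apply _ measurableSet_Icc,
    ← ofReal_integral_eq_lintegral_ofReal P.integrable_density.integrableOn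
      (Eventually.of_forall fun x => (P.density_pos x).le), ENNReal.toReal_ofReal
      (integral_nonneg fun x => (P.density_pos x).le)]

theorem excursionProb_eq (a : ℝ) (n : ℕ) (x u v : ℝ) :
    P.excursionProb a (n + 1) x (Icc u v) =
      ∫ ξ in {ξ : ℕ → ℝ | ∀ k, 1 ≤ k → k < n + 1 → a < walk x ξ k},
        P.stepLaw.real (Icc (u - walk x ξ n) (v - walk x ξ n)) ∂P.incrementLaw := by
  have hind : ProbabilityTheory.iIndepFun (fun (i : ℕ) (ξ : ℕ → ℝ) => ξ i) P.incrementLaw := 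
    ProbabilityTheory.iIndepFun_infinitePi (P := fun _ : ℕ => P.stepLaw) (X := fun _ t => t) (fun _ => measurable_id)
  have h2 := hind.indepFun_finset (Finset.range n) {n} (by simp) (fun i => measurable_pi_apply i)
  have h3 : ProbabilityTheory.IndepFun (fun (ξ : ℕ → ℝ) (i : Finset.range n) => ξ i) (fun ξ : ℕ → ℝ => ξ n) P.incrementLaw :=
    h2.comp measurable_id (measurable_pi_apply (⟨n, by simp⟩ : ({n} : Finset ℕ)))
  have h4 := (ProbabilityTheory.indepFun_iff_map_prod_eq_prod_map_map
    (Measurable.aemeasurable (by fun_prop)) (Measurable.aemeasurable (by fun_prop))).1 h3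
  have h5 : P.incrementLaw.map (fun ξ : ℕ → ℝ => ξ n) = P.stepLaw :=
    Measure.infinitePi_map_eval (fun _ : ℕ => P.stepLaw) n
  rw [h5] at h4
  -- extension of a finite sequence
  let e : (Finset.range n → ℝ) → ℕ → ℝ := fun η i => if h : i ∈ Finset.range n then η ⟨i, h⟩ else 0
  have he : Measurable e := by
    refine measurable_pi_lambda _ fun i => ?_
    by_cases h : i ∈ Finset.range n
    · simp only [e, h, dite_true]; fun_prop
    · simp only [e, h, dite_false]; fun_prop
  have hw : ∀ (ξ : ℕ → ℝ) (k), k ≤ n → walk x (e fun i => ξ i) k = walk x ξ k := by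
    intro ξ k hk
    simp only [walk]
    congr 1
    refine Finset.sum_congr rfl fun i hi => ?_
    have : i ∈ Finset.range n := by simp at hi ⊢; omega
    simp only [e, this, dite_true]
  let A : Set (Finset.range n → ℝ) := e ⁻¹' {ξ : ℕ → ℝ | ∀ k, 1 ≤ k → k < n + 1 → a < walk x ξ k}
  have hA : MeasurableSet A := he (measurableSet_stay a x n)
  let B : Set ((Finset.range n → ℝ) × ℝ) := {p | p.1 ∈ A ∧ walk x (e p.1) n + p.2 ∈ Icc u v}
  have hB : MeasurableSet B := by
    have h6 : Measurable fun p : (Finset.range n → ℝ) × ℝ => walk x (e p.1) n + p.2 :=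
      ((measurable_walk x n).comp (he.comp measurable_fst)).add measurable_snd
    exact (measurable_fst hA).inter (h6 measurableSet_Icc)
  have hA' : ∀ ξ : ℕ → ℝ, (fun i : Finset.range n => ξ i) ∈ A ↔ ∀ k, 1 ≤ k → k < n + 1 → a < walk x ξ k := by
    intro ξ
    simp only [A, mem_preimage, mem_ofPred_eq]
    refine forall_congr' fun k => forall_congr' fun _ => forall_congr' fun hk => ?_
    rw [hw ξ k (by omega)]
  have hset : {ξ : ℕ → ℝ | (∀ k, 1 ≤ k → k < n + 1 → a < walk x ξ k) ∧ walk x ξ (n + 1) ∈ Icc u v}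
      = (fun ξ : ℕ → ℝ => ((fun i : Finset.range n => ξ i), ξ n)) ⁻¹' B := by
    ext ξ
    simp only [mem_ofPred_eq, mem_preimage, B, hA', hw ξ n le_rfl]
    rw [show walk x ξ (n + 1) = walk x ξ n + ξ n by simp [walk, Finset.sum_range_succ, add_assoc]]
  have hmeas : P.incrementLaw {ξ : ℕ → ℝ | (∀ k, 1 ≤ k → k < n + 1 → a < walk x ξ k) ∧ walk x ξ (n + 1) ∈ Icc u v}
      = ∫⁻ ξ in {ξ : ℕ → ℝ | ∀ k, 1 ≤ k → k < n + 1 → a < walk x ξ k},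
        P.stepLaw (Icc (u - walk x ξ n) (v - walk x ξ n)) ∂P.incrementLaw := by
    rw [hset, ← Measure.map_apply (by fun_prop) hB, h4, Measure.prod_apply hB,
      lintegral_map (measurable_measure_prodMk_left hB) (by fun_prop),
      ← lintegral_indicator (measurableSet_stay a x n)]
    refine lintegral_congr fun ξ => ?_
    by_cases h : ∀ k, 1 ≤ k → k < n + 1 → a < walk x ξ k
    · rw [indicator_of_mem (by exact h)]
      congr 1
      ext t
      simp only [B, mem_preimage, mem_ofPred_eq, hA', hw ξ n le_rfl, mem_Icc]
      constructor
      · rintro ⟨-, h1, h2⟩; constructor <;> linarith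
      · rintro ⟨h1, h2⟩; refine ⟨h, ?_, ?_⟩ <;> linarith
    · rw [indicator_of_notMem (by exact h)]
      convert measure_empty (μ := P.stepLaw)
      ext t
      simp only [B, mem_preimage, mem_ofPred_eq, hA', mem_empty_iff_false, iff_false, not_and]
      exact fun h' => absurd h' h
  rw [excursionProb, measureReal_def, hmeas]
  simp only [measureReal_def]
  rw [integral_toReal]
  · have : Measurable fun ξ : ℕ → ℝ => P.stepLaw (Icc (u - walk x ξ n) (v - walk x ξ n)) := by
      have h7 : MeasurableSet {p : (ℕ → ℝ) × ℝ | walk x p.1 n + p.2 ∈ Icc u v} :=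
        (((measurable_walk x n).comp measurable_fst).add measurable_snd) measurableSet_Icc
      convert measurable_measure_prodMk_left (ν := P.stepLaw) h7 using 2 with ξ
      congr 1
      ext t
      simp only [mem_preimage, mem_ofPred_eq, mem_Icc]
      constructor
      · rintro ⟨h1, h2⟩; constructor <;> linarith
      · rintro ⟨h1, h2⟩; constructor <;> linarith
    exact this.aemeasurable
  · exact Eventually.of_forall fun _ => measure_lt_top _ _

/-- The limit that defines `f_{n+1}^a(x, y)` exists, and equals
`𝔼_x [ρ(y - S_n); S_1 > a, …, S_n > a]`. -/
theorem tendsto_excursionDensity (a : ℝ) (n : ℕ) (x y : ℝ) :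
    Tendsto (fun ε => (1 / (2 * ε)) * P.excursionProb a (n + 1) x (Icc (y - ε) (y + ε)))
      (𝓝[>] (0 : ℝ))
      (𝓝 (∫ ξ in {ξ : ℕ → ℝ | ∀ k, 1 ≤ k → k < n + 1 → a < walk x ξ k},
        P.density (y - walk x ξ n) ∂P.incrementLaw)) := by
  simp only [excursionProb_eq, ← integral_const_mul]
  have key : ∀ w ε : ℝ, 0 < ε → P.stepLaw.real (Icc (y - ε - w) (y + ε - w)) =
      ∫ t in (y - w - ε)..(y - w + ε), P.density t := by
    intro w ε hε
    rw [stepLaw_real_Icc, integral_Icc_eq_integral_Ioc, intervalIntegral.integral_of_le (by linarith)]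
    congr 3 <;> ring
  refine tendsto_integral_filter_of_dominated_convergence (fun _ => P.density 0) ?_ ?_
    (integrable_const _) ?_
  · filter_upwards [self_mem_nhdsWithin] with ε hε
    simp only [key _ ε hε]
    have hc : Continuous fun w : ℝ => ∫ t in (y - w - ε)..(y - w + ε), P.density t := by
      have h1 := intervalIntegral.continuous_primitive (fun a b => P.integrable_density.intervalIntegrable (a := a) (b := b)) 0
      have h2 : ∀ w, (∫ t in (y - w - ε)..(y - w + ε), P.density t) =
          (∫ t in (0 : ℝ)..(y - w + ε), P.density t) - ∫ t in (0 : ℝ)..(y - w - ε), P.density t := 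
        fun w => (intervalIntegral.integral_interval_sub_left P.integrable_density.intervalIntegrable
          P.integrable_density.intervalIntegrable).symm
      simp only [h2]
      exact (h1.comp (by fun_prop)).sub (h1.comp (by fun_prop))
    exact ((hc.measurable.comp (measurable_walk x n)).const_mul _).aestronglyMeasurable
  · filter_upwards [self_mem_nhdsWithin] with ε hε
    have hε' : (0 : ℝ) < ε := hε
    refine Eventually.of_forall fun ξ => ?_
    rw [key _ ε hε]
    have h1 := intervalIntegral.norm_integral_le_of_norm_le_const (a := y - walk x ξ n - ε)
      (b := y - walk x ξ n + ε) (f := P.density) (C := P.density 0) (fun t _ => by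
        rw [Real.norm_of_nonneg (P.density_pos t).le]; exact P.density_le t)
    rw [norm_mul, Real.norm_of_nonneg (by positivity)]
    rw [show y - walk x ξ n + ε - (y - walk x ξ n - ε) = 2 * ε by ring, abs_of_pos (by positivity)] at h1
    calc _ ≤ 1 / (2 * ε) * (P.density 0 * (2 * ε)) := by gcongr
      _ = _ := by field_simp
  · refine Eventually.of_forall fun ξ => ?_
    set w := y - walk x ξ n with hw
    have hder : HasDerivAt (fun u => ∫ t in (0 : ℝ)..u, P.density t) (P.density w) w :=
      intervalIntegral.integral_hasDerivAt_right P.integrable_density.intervalIntegrable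
        (P.continuous_density.stronglyMeasurableAtFilter _ _) P.continuous_density.continuousAt
    have hr : HasDerivAt (fun ε : ℝ => (∫ t in (0 : ℝ)..(w + ε), P.density t) -
        ∫ t in (0 : ℝ)..(w - ε), P.density t) (P.density w + P.density w) 0 := by
      have e1 : HasDerivAt (fun ε : ℝ => ∫ t in (0 : ℝ)..(w + ε), P.density t) (P.density w) 0 :=
        HasDerivAt.comp_const_add (f := fun u => ∫ t in (0 : ℝ)..u, P.density t) w 0 (by simpa using hder)
      have e2 : HasDerivAt (fun ε : ℝ => ∫ t in (0 : ℝ)..(w - ε), P.density t) (-P.density w) 0 :=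
        HasDerivAt.comp_const_sub (f := fun u => ∫ t in (0 : ℝ)..u, P.density t) w 0 (by simpa using hder)
      have e3 := e1.sub e2
      rw [sub_neg_eq_add] at e3
      exact e3
    have h1 := (hasDerivAt_iff_tendsto_slope_zero.1 hr).mono_left
      (nhdsWithin_mono 0 (show Ioi (0 : ℝ) ⊆ {0}ᶜ from fun t ht => ne_of_gt ht))
    have h2 := h1.const_mul (1 / 2 : ℝ)
    rw [show 1 / 2 * (P.density w + P.density w) = P.density w by ring] at h2
    refine h2.congr' ?_
    filter_upwards [self_mem_nhdsWithin] with ε hε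
    have hε' : (0 : ℝ) < ε := hε
    rw [key _ ε hε, ← hw, ← intervalIntegral.integral_interval_sub_left (a := (0 : ℝ))
      (b := w + ε) (c := w - ε) P.integrable_density.intervalIntegrable P.integrable_density.intervalIntegrable]
    simp only [zero_add, add_zero, sub_zero, sub_self, smul_eq_mul]
    field_simp

/-- The density as an expectation of the walk. -/
theorem excursionDensity_succ (a : ℝ) (n : ℕ) (x y : ℝ) :
    P.excursionDensity a (n + 1) x y =
      ∫ ξ in {ξ : ℕ → ℝ | ∀ k, 1 ≤ k → k < n + 1 → a < walk x ξ k},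
        P.density (y - walk x ξ n) ∂P.incrementLaw :=
  (P.tendsto_excursionDensity a n x y).limUnder_eq

/-- The critical value `β_c` of the standard wetting model: `e^{-β_c} = ∑_{n ≥ 1} f_n`, where
`f_n = f_n^0(0, 0)`. -/
def criticalValue : ℝ := -Real.log (∑' n : ℕ, P.excursionDensity 0 (n + 1) 0 0)

/-- The resolvent kernel `b_lam^a(x, y) = ∑_{n ≥ 1} e^{-lam n} f_n^a(x, y)`; it is only used for
`x, y ∈ [0, a]`. -/
def resolventKernel (a lam x y : ℝ) : ℝ :=
  ∑' n : ℕ, Real.exp (-lam * ((n : ℝ) + 1)) * P.excursionDensity a (n + 1) x y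

end WalkPotential

/-- `μ` is a (real) eigenvalue of the integral operator on `L²([0, a])` with kernel `K`. -/
def IsKernelEigenvalue (K : ℝ → ℝ → ℝ) (a μ : ℝ) : Prop :=
  ∃ v : ℝ → ℝ, MemLp v 2 (volume.restrict (Icc 0 a)) ∧
    (¬ v =ᵐ[volume.restrict (Icc 0 a)] 0) ∧
    ∀ᵐ x ∂(volume.restrict (Icc 0 a)), ∫ y in Icc 0 a, K x y * v y = μ * v x

/-- `V` is a Perron eigenfunction on `[0, a]` of the kernel `K` with eigenvalue `μ`: it is
continuous and strictly positive on `[0, a]`. -/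
def IsPerronEigenfunction (K : ℝ → ℝ → ℝ) (a μ : ℝ) (V : ℝ → ℝ) : Prop :=
  ContinuousOn V (Icc 0 a) ∧ (∀ x ∈ Icc 0 a, 0 < V x) ∧
    ∀ x ∈ Icc 0 a, ∫ y in Icc 0 a, K x y * V y = μ * V x

namespace WalkPotential

variable (P : WalkPotential)

/-- The Perron eigenvalue `δ_a(lam)`: the largest eigenvalue of the integral operator on
`L²([0, a])` with the resolvent kernel `b_lam^a`. -/
def perronEigenvalue (a lam : ℝ) : ℝ :=
  sSup {μ | IsKernelEigenvalue (P.resolventKernel a lam) a μ}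

/-- The critical value of the strip wetting model with constant pinning on a strip of width `a`:
`β_c(a) = -log δ_a(0)`. -/
def stripCriticalValue (a : ℝ) : ℝ := -Real.log (P.perronEigenvalue a 0)

/-- Condition (A) for a family `φ a`, `0 < a < a₀`, of pinning functions. -/
def ConditionA (a₀ : ℝ) (φ : ℝ → ℝ → ℝ) : Prop :=
  ∃ C : ℝ, 0 < C ∧ ∀ a, 0 < a → a < a₀ →
    IntervalIntegrable (fun x => Real.exp (φ a x)) volume 0 a ∧
    -C ≤ 1 / a * Real.log (∫ x in (0 : ℝ)..a, Real.exp (φ a x - P.criticalValue)) ∧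
    1 / a * Real.log (∫ x in (0 : ℝ)..a, Real.exp (φ a x - P.criticalValue)) ≤ C

end WalkPotential

end

/-! Shifting space by `a` turns the walk that must stay above `a` into the walk killed on leaving
`(0, ∞)`, so on the strip the resolvent kernel at `lam = 0` is `green (x - a) (y - a)`, where
`green` does not depend on `a`. With `G = green 0 0` one has `e^{-β_c} = G`, and everything reduces
to the behaviour of `green` near the corner `(0, 0)` of the quadrant `x, y ≤ 0`.

Finiteness of `G` comes from a bounded supersolution `B (A - e^{-x})` (`exists_supersolution`): the
steps are symmetric with unit variance, so `𝔼 e^{-ξ} > 1`. On the quadrant every term of the series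
is dominated by its value at the origin, so `green` is continuous there; it is also positive and
symmetric. Hence Jentzsch's theorem (`exists_pos_eigenfunction`) gives a positive eigenfunction,
symmetry makes its eigenvalue the largest, and this eigenvalue lies between the extreme row sums of
the kernel.

It remains to estimate row sums. Convexity of `V` makes the part of `green` with at least two steps
decay like a Gaussian in `y` (`exists_green_le`), whence `δ_a(0) ≤ a G e^{-D a²}`. The upper bound
on `V''` makes `green` at least `G - C a` on the strip (`exists_le_green`), whence `δ_a(0) ≥ a G
e^{-C a}`. Logarithms give the two-sided estimate; Condition (A) and the limit follow from it. -/

noncomputable section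

namespace WalkPotential

variable (P : WalkPotential)

/-! ### The potential, and bounds and moments of the step density. -/

theorem differentiable_potential : Differentiable ℝ P.V := P.contDiff.differentiable (by norm_num)

theorem differentiable_deriv_potential : Differentiable ℝ (deriv P.V) := by
  have := (contDiff_succ_iff_deriv (n := 1) (f := P.V)).1
    (by simpa [one_add_one_eq_two] using P.contDiff)
  exact this.2.2.differentiable (by norm_num)

theorem deriv_potential_zero : deriv P.V 0 = 0 := by
  have h : (fun x => P.V (-x)) = P.V := funext P.even
  have h1 := deriv_comp_neg P.V 0
  rw [h, neg_zero] at h1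
  linarith

/-- Quadratic bounds for the increments of the potential on the half-line. -/
theorem exists_potential_bounds : ∃ c : ℝ, 1 < c ∧
    (∀ z s, 0 ≤ z → 0 ≤ s → P.V z + s ^ 2 / (2 * c) ≤ P.V (z + s)) ∧
    ∀ z s, 0 ≤ z → 0 ≤ s → P.V (z + s) ≤ P.V z + c * (z + s) * s := by
  obtain ⟨c, hc, h⟩ := P.convex
  have hc0 : 0 < c := by linarith
  have d1 : ∀ x, HasDerivAt P.V (deriv P.V x) x := fun x => (P.differentiable_potential x).hasDerivAt
  have d2 : ∀ x, HasDerivAt (deriv P.V) (deriv (deriv P.V) x) x :=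
    fun x => (P.differentiable_deriv_potential x).hasDerivAt
  have q : ∀ k x : ℝ, HasDerivAt (fun t => k * t ^ 2 / 2) (k * x) x := by
    intro k x
    have := (((hasDerivAt_id x).pow 2).const_mul k).div_const 2
    exact this.congr_deriv (by simp; ring)
  have l : ∀ k x : ℝ, HasDerivAt (fun t => k * t) k x := by
    intro k x
    simpa using (hasDerivAt_id x).const_mul k
  -- The bounds on `V''` are integrated twice from `0`, where `V'` vanishes by evenness: first to `t
  -- / c ≤ V' t ≤ c t` for `t ≥ 0`, then to the monotonicity of `V` minus a parabola on the
  -- half-line.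
  have m1 : Monotone fun t => deriv P.V t - 1 / c * t :=
    monotone_of_hasDerivAt_nonneg (fun x => (d2 x).sub (l (1 / c) x)) fun x => by
      simpa using (h x).1
  have m2 : Antitone fun t => deriv P.V t - c * t :=
    antitone_of_hasDerivAt_nonpos (fun x => (d2 x).sub (l c x)) fun x => by
      simpa using (h x).2
  have b1 : ∀ t, 0 ≤ t → 1 / c * t ≤ deriv P.V t := fun t ht => by
    have := m1 ht
    simp only [P.deriv_potential_zero] at this; linarith
  have b2 : ∀ t, 0 ≤ t → deriv P.V t ≤ c * t := fun t ht => by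
    have := m2 ht
    simp only [P.deriv_potential_zero] at this; linarith
  have n1 : MonotoneOn (fun t => P.V t - 1 / c * t ^ 2 / 2) (Ici 0) := by
    refine monotoneOn_of_hasDerivWithinAt_nonneg (convex_Ici 0)
      (fun x _ => ((d1 x).sub (q (1 / c) x)).continuousAt.continuousWithinAt)
      (fun x _ => ((d1 x).sub (q (1 / c) x)).hasDerivWithinAt) fun x hx => ?_
    simp only [interior_Ici, mem_Ioi] at hx
    linarith [b1 x hx.le]
  have n2 : AntitoneOn (fun t => P.V t - c * t ^ 2 / 2) (Ici 0) := by
    refine antitoneOn_of_hasDerivWithinAt_nonpos (convex_Ici 0)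
      (fun x _ => ((d1 x).sub (q c x)).continuousAt.continuousWithinAt)
      (fun x _ => ((d1 x).sub (q c x)).hasDerivWithinAt) fun x hx => ?_
    simp only [interior_Ici, mem_Ioi] at hx
    linarith [b2 x hx.le]
  refine ⟨c, hc, fun z s hz hs => ?_, fun z s hz hs => ?_⟩
  · have := n1 (mem_Ici.2 hz) (mem_Ici.2 (add_nonneg hz hs)) (by linarith)
    simp only at this
    have e : 0 ≤ 1 / c * (z * s) := by positivity
    have e2 : s ^ 2 / (2 * c) = 1 / c * s ^ 2 / 2 := by field_simp
    rw [e2]; linarith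
  · have := n2 (mem_Ici.2 hz) (mem_Ici.2 (add_nonneg hz hs)) (by linarith)
    simp only at this
    -- The increment of `c t² / 2` from `z` to `z + s` is `c (z s + s² / 2)`, which is at most `c (z
    -- + s) s`.
    nlinarith [mul_nonneg hc0.le (sq_nonneg s)]

theorem density_neg (x : ℝ) : P.density (-x) = P.density x := by
  simp only [density, P.even]

theorem density_sub_comm (x y : ℝ) : P.density (x - y) = P.density (y - x) := by
  rw [← P.density_neg, neg_sub]

/-- Comparison of the step densities seen from `x ≤ 0` and from `0`. -/
theorem exists_density_bounds : ∃ c : ℝ, 1 < c ∧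
    (∀ z x, 0 ≤ z → x ≤ 0 → P.density (z - x) ≤ Real.exp (-(x ^ 2 / (2 * c))) * P.density z) ∧
    ∀ z x, 0 ≤ z → x ≤ 0 → (1 - c * (z - x) * (-x)) * P.density z ≤ P.density (z - x) := by
  obtain ⟨c, hc, h1, h2⟩ := P.exists_potential_bounds
  have hκ := P.partition_pos
  refine ⟨c, hc, fun z x hz hx => ?_, fun z x hz hx => ?_⟩
  · unfold density
    rw [← mul_div_assoc, ← Real.exp_add]
    refine div_le_div_of_nonneg_right (Real.exp_le_exp.2 ?_) hκ.le
    have := h1 z (-x) hz (by linarith)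
    rw [neg_sq, ← sub_eq_add_neg] at this
    linarith
  · unfold density
    rw [← mul_div_assoc]
    refine div_le_div_of_nonneg_right ?_ hκ.le
    have := h2 z (-x) hz (by linarith)
    rw [← sub_eq_add_neg] at this
    calc _ ≤ Real.exp (-(c * (z - x) * (-x))) * Real.exp (-P.V z) := by
          gcongr
          linarith [Real.add_one_le_exp (-(c * (z - x) * (-x)))]
      _ = Real.exp (-(c * (z - x) * (-x)) + -P.V z) := (Real.exp_add _ _).symm
      _ ≤ _ := Real.exp_le_exp.2 (by linarith)

theorem density_sub_le {z x : ℝ} (hz : 0 ≤ z) (hx : x ≤ 0) : P.density (z - x) ≤ P.density z := by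
  obtain ⟨c, hc, h1, -⟩ := P.exists_density_bounds
  refine (h1 z x hz hx).trans (mul_le_of_le_one_left (P.density_pos z).le ?_)
  rw [Real.exp_le_one_iff]
  have : 0 ≤ x ^ 2 / (2 * c) := by positivity
  linarith

theorem exists_density_le_gaussian : ∃ c : ℝ, 1 < c ∧
    ∀ x, P.density x ≤ Real.exp (-(x ^ 2 / (2 * c))) * P.density 0 := by
  obtain ⟨c, hc, h1, -⟩ := P.exists_density_bounds
  refine ⟨c, hc, fun x => ?_⟩
  have := h1 0 (-|x|) le_rfl (by simp)
  rw [neg_sq, sq_abs, zero_sub, neg_neg] at this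
  rcases abs_choice x with h | h <;> rw [h] at this
  · exact this
  · rwa [P.density_neg] at this

/-- The Gaussian bound absorbs the exponential: completing the square costs the factor `e^{c b²}`
and half of the Gaussian rate. -/
theorem integrable_density_mul_exp (b : ℝ) :
    Integrable fun x => P.density x * Real.exp (b * x) := by
  obtain ⟨c, hc, h⟩ := P.exists_density_le_gaussian
  have hc0 : 0 < c := by linarith
  have hg : Integrable fun x : ℝ => (P.density 0 * Real.exp (c * b ^ 2)) *
      Real.exp (-(1 / (4 * c)) * x ^ 2) :=
    (integrable_exp_neg_mul_sq (by positivity)).const_mul _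
  refine hg.mono' ((P.continuous_density.mul (by fun_prop)).aestronglyMeasurable)
    (Eventually.of_forall fun x => ?_)
  have h0 := P.density_pos x
  have h00 := P.density_pos 0
  rw [Real.norm_of_nonneg (by positivity)]
  calc _ ≤ Real.exp (-(x ^ 2 / (2 * c))) * P.density 0 * Real.exp (b * x) := by
        gcongr; exact h x
    _ = P.density 0 * Real.exp (-(x ^ 2 / (2 * c)) + b * x) := by rw [Real.exp_add]; ring
    _ ≤ P.density 0 * Real.exp (c * b ^ 2 + -(1 / (4 * c)) * x ^ 2) := by
        refine mul_le_mul_of_nonneg_left (Real.exp_le_exp.2 ?_) h00.le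
        have : c * b ^ 2 + -(1 / (4 * c)) * x ^ 2 - (-(x ^ 2 / (2 * c)) + b * x) =
          (x - 2 * c * b) ^ 2 / (4 * c) := by field_simp; ring
        have : 0 ≤ (x - 2 * c * b) ^ 2 / (4 * c) := by positivity
        linarith
    _ = _ := by rw [Real.exp_add]; ring

/-- A non-integrable function has integral `0` by convention, which contradicts the normalisation of
the second moment to `1`. -/
theorem integrable_density_mul_sq : Integrable fun x => x ^ 2 * P.density x := by
  by_contra h
  have h1 := P.second_moment
  have h2 := integral_undef h
  unfold density at h2
  rw [h2] at h1
  exact zero_ne_one h1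

/-- By symmetry twice this moment is the mean of `e^{-x} + e^x ≥ 2 + x² / 2`, and the variance is
`1`. The excess over `1` is what makes the supersolution below work. -/
theorem exponential_moment_ge : 5 / 4 ≤ ∫ x, P.density x * Real.exp (-x) := by
  have i1 : Integrable fun x => P.density x * Real.exp (-x) := by
    simpa using P.integrable_density_mul_exp (-1)
  have i2 : Integrable fun x => P.density x * Real.exp x := by
    simpa using P.integrable_density_mul_exp 1
  have e : ∫ x, P.density x * Real.exp (-x) = ∫ x, P.density x * Real.exp x := by
    rw [← integral_neg_eq_self]
    simp only [P.density_neg, neg_neg]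
  have h : ∫ x, (2 * P.density x + 1 / 2 * (x ^ 2 * P.density x)) ≤
      ∫ x, (P.density x * Real.exp (-x) + P.density x * Real.exp x) := by
    refine integral_mono ((P.integrable_density.const_mul 2).add
      (P.integrable_density_mul_sq.const_mul _))
      (i1.add i2) fun x => ?_
    have h1 : 2 + x ^ 2 / 2 ≤ Real.exp (-x) + Real.exp x := by
      rcases le_total 0 x with hx | hx
      · linarith [Real.quadratic_le_exp_of_nonneg hx, Real.add_one_le_exp (-x)]
      · have := Real.quadratic_le_exp_of_nonneg (neg_nonneg.2 hx)
        linarith [Real.add_one_le_exp x, neg_sq x]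
    have h2 := P.density_pos x
    simp only
    nlinarith
  rw [integral_add (P.integrable_density.const_mul 2) (P.integrable_density_mul_sq.const_mul _),
    integral_add i1 i2, ← e, integral_const_mul, integral_const_mul, P.integral_density] at h
  have h3 : ∫ x, x ^ 2 * P.density x = 1 := P.second_moment
  linarith

/-- The density of `z` with weight `1 + z` is integrable on the half-line. -/
theorem integrableOn_weight_mul_density :
    IntegrableOn (fun z => (z + 1) * P.density z) (Ioi 0) := by
  have : Integrable fun z => 2 * P.density z + z ^ 2 * P.density z :=
    (P.integrable_density.const_mul 2).add P.integrable_density_mul_sq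
  refine this.integrableOn.mono' ((Continuous.mul (by fun_prop)
    P.continuous_density).aestronglyMeasurable) ?_
  filter_upwards [ae_restrict_mem measurableSet_Ioi] with z hz
  have hz' : 0 < z := hz
  have h0 := P.density_pos z
  rw [Real.norm_of_nonneg (by positivity)]
  nlinarith [sq_nonneg (z - 1), mul_nonneg h0.le (sq_nonneg (z - 1)), mul_nonneg h0.le hz'.le]

/-! ### The walk killed on leaving the positive half-line. -/

/-- The density at `y` of the `(n+1)`-st position of the walk started at `x` and killed when it
leaves the positive half-line at one of the times `1, …, n`. -/
def killedDensity : ℕ → ℝ → ℝ → ℝ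
  | 0, x, y => P.density (y - x)
  | n + 1, x, y => ∫ z in Ioi 0, P.density (z - x) * killedDensity n z y

theorem killedDensity_zero (x y : ℝ) : P.killedDensity 0 x y = P.density (y - x) := rfl

theorem killedDensity_succ (n : ℕ) (x y : ℝ) :
    P.killedDensity (n + 1) x y = ∫ z in Ioi 0, P.density (z - x) * P.killedDensity n z y := rfl

theorem killedDensity_nonneg (n : ℕ) (x y : ℝ) : 0 ≤ P.killedDensity n x y := by
  induction n generalizing x with
  | zero => exact (P.density_pos _).le
  | succ n ih => exact integral_nonneg fun z => mul_nonneg (P.density_pos _).le (ih z)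

theorem measurable_density : Measurable P.density := P.continuous_density.measurable

theorem measurable_killedDensity (n : ℕ) :
    Measurable fun p : ℝ × ℝ => P.killedDensity n p.1 p.2 := by
  induction n with
  | zero => exact P.measurable_density.comp (by fun_prop)
  | succ n ih =>
    have h : Measurable fun q : (ℝ × ℝ) × ℝ =>
        P.density (q.2 - q.1.1) * P.killedDensity n q.2 q.1.2 :=
      (P.measurable_density.comp (by fun_prop)).mul
        (ih.comp (measurable_snd.prodMk measurable_fst.snd))
    exact (h.stronglyMeasurable.integral_prod_right' (ν := volume.restrict (Ioi 0))).measurable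

theorem integrable_density_sub (x : ℝ) : Integrable fun z => P.density (z - x) :=
  P.integrable_density.comp_sub_right x

theorem integral_density_sub (x : ℝ) : ∫ z, P.density (z - x) = 1 := by
  rw [integral_sub_right_eq_self P.density x, P.integral_density]

theorem setIntegral_density_sub_le (x : ℝ) (s : Set ℝ) : ∫ z in s, P.density (z - x) ≤ 1 := by
  rw [← P.integral_density_sub x]
  exact setIntegral_le_integral (P.integrable_density_sub x)
    (Eventually.of_forall fun z => (P.density_pos _).le)

/-- A bounded measurable function is integrable against the step density. -/
theorem integrable_density_sub_mul {φ : ℝ → ℝ} (hφ : Measurable φ) {C : ℝ}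
    (hC : ∀ z, |φ z| ≤ C) (x : ℝ) : Integrable fun z => P.density (z - x) * φ z :=
  (P.integrable_density_sub x).mul_bdd (c := C) hφ.aestronglyMeasurable (Eventually.of_forall hC)

theorem killedDensity_le (n : ℕ) (x y : ℝ) : P.killedDensity n x y ≤ P.density 0 := by
  induction n generalizing x with
  | zero => exact P.density_le _
  | succ n ih =>
    have hm : Measurable fun z => P.killedDensity n z y :=
      (P.measurable_killedDensity n).comp (measurable_id.prodMk measurable_const)
    calc P.killedDensity (n + 1) x y ≤ ∫ z in Ioi 0, P.density (z - x) * P.density 0 := by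
          refine integral_mono (P.integrable_density_sub_mul hm (C := P.density 0) (fun z => ?_)
            x).integrableOn ((P.integrable_density_sub x).mul_const _).integrableOn fun z => ?_
          · rw [abs_of_nonneg (P.killedDensity_nonneg n z y)]; exact ih z
          · exact mul_le_mul_of_nonneg_left (ih z) (P.density_pos _).le
      _ = (∫ z in Ioi 0, P.density (z - x)) * P.density 0 := integral_mul_const _ _
      _ ≤ 1 * P.density 0 := by
          gcongr
          · exact (P.density_pos 0).le
          · exact P.setIntegral_density_sub_le x _
      _ = _ := one_mul _

theorem abs_killedDensity_le (n : ℕ) (x y : ℝ) : |P.killedDensity n x y| ≤ P.density 0 := by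
  rw [abs_of_nonneg (P.killedDensity_nonneg n x y)]; exact P.killedDensity_le n x y

theorem measurable_killedDensity_left (n : ℕ) (y : ℝ) :
    Measurable fun z => P.killedDensity n z y :=
  (P.measurable_killedDensity n).comp (measurable_id.prodMk measurable_const)

theorem integrable_density_mul_killedDensity (n : ℕ) (x y : ℝ) :
    Integrable fun z => P.density (z - x) * P.killedDensity n z y :=
  P.integrable_density_sub_mul (P.measurable_killedDensity_left n y)
    (fun z => P.abs_killedDensity_le n z y) x

/-- Decomposition at the last step instead of the first one. -/
theorem killedDensity_succ_last (n : ℕ) (x y : ℝ) :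
    P.killedDensity (n + 1) x y = ∫ z in Ioi 0, P.killedDensity n x z * P.density (y - z) := by
  induction n generalizing x with
  | zero => rfl
  | succ n ih =>
    have hint : Integrable (fun p : ℝ × ℝ =>
        P.density (p.1 - x) * (P.killedDensity n p.1 p.2 * P.density (y - p.2)))
        ((volume.restrict (Ioi 0)).prod (volume.restrict (Ioi 0))) := by
      have h1 : Integrable (fun p : ℝ × ℝ => P.density (p.1 - x) * P.density (p.2 - y))
          ((volume.restrict (Ioi 0)).prod (volume.restrict (Ioi 0))) :=
        (P.integrable_density_sub x).integrableOn.mul_prod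
          (P.integrable_density_sub y).integrableOn
      have h2 := h1.mul_bdd (c := P.density 0) (P.measurable_killedDensity n).aestronglyMeasurable
        (Eventually.of_forall fun p => P.abs_killedDensity_le n p.1 p.2)
      refine h2.congr (Eventually.of_forall fun p => ?_)
      simp only [P.density_sub_comm p.2 y]; ring
    rw [killedDensity_succ]
    calc _ = ∫ z in Ioi 0, ∫ w in Ioi 0,
            P.density (z - x) * (P.killedDensity n z w * P.density (y - w)) := by
          refine integral_congr_ae (Eventually.of_forall fun z => ?_)
          simp only
          rw [ih z, integral_const_mul]
      _ = ∫ w in Ioi 0, ∫ z in Ioi 0,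
            P.density (z - x) * (P.killedDensity n z w * P.density (y - w)) :=
          integral_integral_swap hint
      _ = _ := by
          refine integral_congr_ae (Eventually.of_forall fun w => ?_)
          simp only
          rw [killedDensity_succ, ← integral_mul_const]
          simp only [mul_assoc]

/-- Path reversal: the step density is even, and decomposing at the first step mirrors decomposing
at the last. -/
theorem killedDensity_comm (n : ℕ) (x y : ℝ) : P.killedDensity n x y = P.killedDensity n y x := by
  induction n generalizing x y with
  | zero => exact P.density_sub_comm y x
  | succ n ih =>
    rw [killedDensity_succ, killedDensity_succ_last]
    refine integral_congr_ae (Eventually.of_forall fun z => ?_)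
    simp only
    rw [ih z y, P.density_sub_comm z x, mul_comm]

/-! ### Comparison with the value at the origin -/

/-- Moving the start from `0` to `x ≤ 0` lengthens every first step into the half-line, and the
density decreases with the length. The sign of `y` matters only for `n = 0`, when the first step
lands at `y`. -/
theorem killedDensity_le_origin_left (n : ℕ) {x y : ℝ} (hx : x ≤ 0) (hy : 0 ≤ y) :
    P.killedDensity n x y ≤ P.killedDensity n 0 y := by
  cases n with
  | zero => simpa [killedDensity_zero] using P.density_sub_le hy hx
  | succ n =>
    refine setIntegral_mono_on (P.integrable_density_mul_killedDensity n x y).integrableOn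
      (P.integrable_density_mul_killedDensity n 0 y).integrableOn measurableSet_Ioi fun z hz => ?_
    refine mul_le_mul_of_nonneg_right ?_ (P.killedDensity_nonneg _ _ _)
    simpa using P.density_sub_le (le_of_lt hz) hx

theorem killedDensity_succ_le_left (n : ℕ) {x : ℝ} (hx : x ≤ 0) (y : ℝ) :
    P.killedDensity (n + 1) x y ≤ P.killedDensity (n + 1) 0 y := by
  refine setIntegral_mono_on (P.integrable_density_mul_killedDensity n x y).integrableOn
    (P.integrable_density_mul_killedDensity n 0 y).integrableOn measurableSet_Ioi fun z hz => ?_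
  refine mul_le_mul_of_nonneg_right ?_ (P.killedDensity_nonneg _ _ _)
  simpa using P.density_sub_le (le_of_lt hz) hx

theorem killedDensity_le_origin (n : ℕ) {x y : ℝ} (hx : x ≤ 0) (hy : y ≤ 0) :
    P.killedDensity n x y ≤ P.killedDensity n 0 0 := by
  cases n with
  | zero => simpa [killedDensity_zero] using P.density_le (y - x)
  | succ n =>
    refine (P.killedDensity_succ_le_left n hx y).trans ?_
    rw [killedDensity_comm]
    exact P.killedDensity_succ_le_left n hy 0

/-- By symmetry the last step is a first step from `y` into the half-line, and convexity of `V`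
gives it the Gaussian factor. The one-step density is excluded: it does not decay along `x = y`. -/
theorem exists_killedDensity_gaussian_decay : ∃ c : ℝ, 1 < c ∧ ∀ (n : ℕ) (x y : ℝ), x ≤ 0 →
    y ≤ 0 → P.killedDensity (n + 1) x y ≤
      Real.exp (-(y ^ 2 / (2 * c))) * P.killedDensity (n + 1) 0 0 := by
  obtain ⟨c, hc, h, -⟩ := P.exists_density_bounds
  refine ⟨c, hc, fun n x y hx hy => (P.killedDensity_succ_le_left n hx y).trans ?_⟩
  rw [killedDensity_comm, killedDensity_succ, killedDensity_succ, ← integral_const_mul]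
  refine setIntegral_mono_on (P.integrable_density_mul_killedDensity n y 0).integrableOn
    ((P.integrable_density_mul_killedDensity n 0 0).integrableOn.const_mul _)
    measurableSet_Ioi fun z hz => ?_
  rw [sub_zero, ← mul_assoc]
  exact mul_le_mul_of_nonneg_right (h z y (le_of_lt hz) hy) (P.killedDensity_nonneg _ _ _)

/-! ### Continuity -/

theorem continuous_killedDensity_right (n : ℕ) (x : ℝ) :
    Continuous fun y => P.killedDensity n x y := by
  induction n generalizing x with
  | zero => exact P.continuous_density.comp (by fun_prop)
  | succ n ih =>
    refine continuous_of_dominated (F := fun y z => P.density (z - x) * P.killedDensity n z y)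
      (bound := fun z => P.density (z - x) * P.density 0)
      (fun y => (P.integrable_density_mul_killedDensity n x y).integrableOn.aestronglyMeasurable)
      (fun y => Eventually.of_forall fun z => ?_)
      ((P.integrable_density_sub x).mul_const _).integrableOn
      (Eventually.of_forall fun z => (ih z).const_mul _)
    rw [norm_mul, Real.norm_of_nonneg (P.density_pos _).le]
    exact mul_le_mul_of_nonneg_left (P.abs_killedDensity_le n z y) (P.density_pos _).le

/-- The restriction to `x ≤ 0` provides a majorant independent of `x`, since `P.density (z - x) ≤
P.density z` there. -/
theorem continuousOn_killedDensity (n : ℕ) :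
    ContinuousOn (fun p : ℝ × ℝ => P.killedDensity n p.1 p.2) (Iic 0 ×ˢ Iic 0) := by
  cases n with
  | zero => exact (P.continuous_density.comp (by fun_prop)).continuousOn
  | succ n =>
    refine continuousOn_of_dominated
      (F := fun (p : ℝ × ℝ) z => P.density (z - p.1) * P.killedDensity n z p.2)
      (bound := fun z => P.density z * P.density 0)
      (fun p _ =>
        (P.integrable_density_mul_killedDensity n p.1 p.2).integrableOn.aestronglyMeasurable)
      (fun p hp => ?_) (P.integrable_density.mul_const _).integrableOn
      (Eventually.of_forall fun z => Continuous.continuousOn ?_)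
    · filter_upwards [ae_restrict_mem measurableSet_Ioi] with z hz
      rw [norm_mul, Real.norm_of_nonneg (P.density_pos _).le]
      exact mul_le_mul (P.density_sub_le (le_of_lt hz) hp.1) (P.abs_killedDensity_le n z _)
        (abs_nonneg _) (P.density_pos _).le
    · exact (P.continuous_density.comp (by fun_prop)).mul
        ((P.continuous_killedDensity_right n z).comp continuous_snd)

/-! ### The Green function -/

/-- A supersolution: `A - e^{-x}` decreases on average along the killed walk. -/
theorem exists_supersolution : ∃ A B : ℝ, 1 ≤ A ∧ 0 < B ∧ ∀ x, 0 ≤ x →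
    P.density x + ∫ z in Ioi 0, P.density (z - x) * (B * (A - Real.exp (-z))) ≤
      B * (A - Real.exp (-x)) := by
  set M₁ := ∫ t, P.density t * Real.exp (-t) with hM₁
  set M₂ := ∫ t, P.density t * Real.exp (-2 * t) with hM₂
  have hM : 5 / 4 ≤ M₁ := P.exponential_moment_ge
  have i1 : Integrable fun t => P.density t * Real.exp (-t) := by
    simpa using P.integrable_density_mul_exp (-1)
  have i2 : Integrable fun t => P.density t * Real.exp (-2 * t) :=
    P.integrable_density_mul_exp (-2)
  have hM₂0 : 0 ≤ M₂ := integral_nonneg fun t => mul_nonneg (P.density_pos t).le (Real.exp_pos _).le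
  obtain ⟨c, hc, hg⟩ := P.exists_density_le_gaussian
  -- `A` makes `M₂ / (4 A) ≤ 1 / 8`, so that of the excess `M₁ - 1 ≥ 1 / 4` at least `1 / 8`
  -- survives. `B` is chosen so that `B / 8 * e^{-x}` pays for `P.density x`.
  set A := 1 + 2 * M₂ with hA
  set B := 8 * (P.density 0 * Real.exp (c / 2)) with hB
  have hρ0 := P.density_pos 0
  have hA1 : 1 ≤ A := by linarith
  have hA0 : 0 < A := by linarith
  refine ⟨A, B, hA1, by positivity, fun x hx => ?_⟩
  -- To extend the integral to the whole line, where `A - u` with `u = e^{-z}` may be negative, add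
  -- `u² / (4 A)`. The sum is the square `(2 A - u)² / (4 A)`, and its mean is explicit.
  have key : ∫ z in Ioi 0, P.density (z - x) * (A - Real.exp (-z)) ≤
      A - M₁ * Real.exp (-x) + M₂ * Real.exp (-2 * x) / (4 * A) := by
    have j1 : Integrable fun z => P.density (z - x) * Real.exp (-(z - x)) := i1.comp_sub_right x
    have j2 : Integrable fun z => P.density (z - x) * Real.exp (-2 * (z - x)) := i2.comp_sub_right x
    have j0 := P.integrable_density_sub x
    have J₀ : Integrable fun z => A * P.density (z - x) -
        Real.exp (-x) * (P.density (z - x) * Real.exp (-(z - x))) :=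
      (j0.const_mul A).sub (j1.const_mul _)
    have J : Integrable fun z => A * P.density (z - x) -
        Real.exp (-x) * (P.density (z - x) * Real.exp (-(z - x))) +
        Real.exp (-2 * x) / (4 * A) * (P.density (z - x) * Real.exp (-2 * (z - x))) :=
      J₀.add (j2.const_mul _)
    have hsplit : ∀ z, A * P.density (z - x) -
        Real.exp (-x) * (P.density (z - x) * Real.exp (-(z - x))) +
        Real.exp (-2 * x) / (4 * A) * (P.density (z - x) * Real.exp (-2 * (z - x))) =
        P.density (z - x) * (A - Real.exp (-z) + Real.exp (-z) ^ 2 / (4 * A)) := by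
      intro z
      have e1 : Real.exp (-z) = Real.exp (-x) * Real.exp (-(z - x)) := by
        rw [← Real.exp_add]; ring_nf
      have e2 : Real.exp (-z) ^ 2 = Real.exp (-2 * x) * Real.exp (-2 * (z - x)) := by
        rw [← Real.exp_add, ← Real.exp_nat_mul]; push_cast; ring_nf
      rw [e2, e1]; field_simp
    have hpos : ∀ z, 0 ≤ A - Real.exp (-z) + Real.exp (-z) ^ 2 / (4 * A) := by
      intro z
      have : A - Real.exp (-z) + Real.exp (-z) ^ 2 / (4 * A) =
        (2 * A - Real.exp (-z)) ^ 2 / (4 * A) := by field_simp; ring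
      rw [this]; positivity
    have hle : ∫ z in Ioi 0, P.density (z - x) * (A - Real.exp (-z)) ≤
        ∫ z, A * P.density (z - x) -
        Real.exp (-x) * (P.density (z - x) * Real.exp (-(z - x))) +
        Real.exp (-2 * x) / (4 * A) * (P.density (z - x) * Real.exp (-2 * (z - x))) := by
      refine le_trans (integral_mono_of_nonneg ?_ J.integrableOn ?_)
        (setIntegral_le_integral J (Eventually.of_forall fun z => ?_))
      · filter_upwards [ae_restrict_mem measurableSet_Ioi] with z hz
        refine mul_nonneg (P.density_pos _).le ?_
        have : Real.exp (-z) ≤ 1 := Real.exp_le_one_iff.2 (by simpa using le_of_lt hz)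
        linarith
      · refine Eventually.of_forall fun z => ?_
        simp only
        rw [hsplit z]
        refine mul_le_mul_of_nonneg_left ?_ (P.density_pos _).le
        have : 0 ≤ Real.exp (-z) ^ 2 / (4 * A) := by positivity
        linarith
      · simp only [Pi.zero_apply]
        rw [hsplit z]
        exact mul_nonneg (P.density_pos _).le (hpos z)
    refine hle.trans (le_of_eq ?_)
    rw [integral_add J₀ (j2.const_mul _),
      integral_sub (j0.const_mul A) (j1.const_mul _), integral_const_mul, integral_const_mul,
      integral_const_mul, P.integral_density_sub,
      integral_sub_right_eq_self (fun t => P.density t * Real.exp (-t)) x,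
      integral_sub_right_eq_self (fun t => P.density t * Real.exp (-2 * t)) x, ← hM₁, ← hM₂]
    ring
  have h1 : M₂ * Real.exp (-2 * x) / (4 * A) ≤ 1 / 8 * Real.exp (-x) := by
    have : Real.exp (-2 * x) ≤ Real.exp (-x) := Real.exp_le_exp.2 (by linarith)
    rw [div_le_iff₀ (by positivity)]
    have := mul_le_mul_of_nonneg_left this hM₂0
    nlinarith [Real.exp_pos (-x), mul_nonneg hM₂0 (Real.exp_pos (-x)).le]
  have h2 : P.density x ≤ P.density 0 * Real.exp (c / 2) * Real.exp (-x) := by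
    refine (hg x).trans ?_
    rw [mul_assoc, ← Real.exp_add, mul_comm]
    refine mul_le_mul_of_nonneg_left (Real.exp_le_exp.2 ?_) hρ0.le
    have : c / 2 + -x + x ^ 2 / (2 * c) = (x - c) ^ 2 / (2 * c) := by field_simp; ring
    have : 0 ≤ (x - c) ^ 2 / (2 * c) := by positivity
    linarith
  have h3 : ∫ z in Ioi 0, P.density (z - x) * (B * (A - Real.exp (-z))) =
      B * ∫ z in Ioi 0, P.density (z - x) * (A - Real.exp (-z)) := by
    rw [← integral_const_mul]
    congr 1; ext z; ring
  rw [h3]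
  have hB0 : 0 < B := by positivity
  have h4 : ∫ z in Ioi 0, P.density (z - x) * (A - Real.exp (-z)) ≤
      A - Real.exp (-x) - 1 / 8 * Real.exp (-x) := by
    nlinarith [Real.exp_pos (-x)]
  have h5 := mul_le_mul_of_nonneg_left h4 hB0.le
  nlinarith

/-- The Green function of the killed walk is bounded on the half-line. -/
theorem exists_sum_killedDensity_le : ∃ C : ℝ, 0 < C ∧ ∀ (N : ℕ) (x : ℝ), 0 ≤ x →
    ∑ n ∈ Finset.range N, P.killedDensity n x 0 ≤ C := by
  obtain ⟨A, B, hA, hB, h⟩ := P.exists_supersolution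
  -- Induction on the number of terms: the first-step decomposition expresses `N + 1` terms through
  -- `N` terms, and the supersolution inequality closes the step.
  have key : ∀ (N : ℕ) (x : ℝ), 0 ≤ x →
      ∑ n ∈ Finset.range N, P.killedDensity n x 0 ≤ B * (A - Real.exp (-x)) := by
    intro N
    induction N with
    | zero =>
      intro x hx
      have : Real.exp (-x) ≤ 1 := Real.exp_le_one_iff.2 (by linarith)
      simpa using mul_nonneg hB.le (by linarith)
    | succ N ih =>
      intro x hx
      refine le_trans ?_ (h x hx)
      rw [Finset.sum_range_succ', add_comm]
      refine add_le_add (by simp [killedDensity_zero, P.density_neg]) ?_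
      simp only [killedDensity_succ]
      rw [← integral_finsetSum _ fun n _ =>
        (P.integrable_density_mul_killedDensity n x 0).integrableOn]
      refine setIntegral_mono_on (integrable_finsetSum _ fun n _ =>
        (P.integrable_density_mul_killedDensity n x 0).integrableOn) ?_ measurableSet_Ioi
        fun z hz => ?_
      · refine Integrable.mono' (g := fun z => P.density (z - x) * (B * A))
          ((P.integrable_density_sub x).mul_const _).integrableOn ?_ ?_
        · exact ((P.continuous_density.comp (by fun_prop)).mul
            (by fun_prop)).aestronglyMeasurable
        · filter_upwards [ae_restrict_mem measurableSet_Ioi] with z hz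
          have h1 : Real.exp (-z) ≤ 1 := Real.exp_le_one_iff.2 (by simpa using le_of_lt hz)
          have h2 := Real.exp_pos (-z)
          rw [Real.norm_of_nonneg (mul_nonneg (P.density_pos _).le
            (mul_nonneg hB.le (by linarith)))]
          refine mul_le_mul_of_nonneg_left ?_ (P.density_pos _).le
          exact mul_le_mul_of_nonneg_left (by linarith) hB.le
      · rw [← Finset.mul_sum]
        exact mul_le_mul_of_nonneg_left (ih z (le_of_lt hz)) (P.density_pos _).le
  refine ⟨B * A, by positivity, fun N x hx => (key N x hx).trans ?_⟩
  exact mul_le_mul_of_nonneg_left (by linarith [Real.exp_pos (-x)]) hB.le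

theorem summable_killedDensity_origin : Summable fun n => P.killedDensity n 0 0 := by
  obtain ⟨C, -, h⟩ := P.exists_sum_killedDensity_le
  exact summable_of_sum_range_le (fun n => P.killedDensity_nonneg n 0 0) fun N => h N 0 le_rfl

theorem summable_killedDensity {x y : ℝ} (hx : x ≤ 0) (hy : y ≤ 0) :
    Summable fun n => P.killedDensity n x y :=
  P.summable_killedDensity_origin.of_nonneg_of_le (fun n => P.killedDensity_nonneg n x y)
    fun n => P.killedDensity_le_origin n hx hy

/-- The Green function of the killed walk. -/
def green (x y : ℝ) : ℝ := ∑' n, P.killedDensity n x y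

/-- Weierstrass test, with the series at the origin as majorant. -/
theorem continuousOn_green : ContinuousOn (fun p : ℝ × ℝ => P.green p.1 p.2) (Iic 0 ×ˢ Iic 0) := by
  refine continuousOn_tsum (fun n => P.continuousOn_killedDensity n)
    P.summable_killedDensity_origin fun n p hp => ?_
  rw [Real.norm_of_nonneg (P.killedDensity_nonneg n _ _)]
  exact P.killedDensity_le_origin n hp.1 hp.2

theorem green_comm (x y : ℝ) : P.green x y = P.green y x :=
  tsum_congr fun n => P.killedDensity_comm n x y

theorem green_eq_density_add {x y : ℝ} (hx : x ≤ 0) (hy : y ≤ 0) :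
    P.green x y = P.density (y - x) + ∑' n, P.killedDensity (n + 1) x y :=
  (P.summable_killedDensity hx hy).tsum_eq_zero_add

theorem green_pos {x y : ℝ} (hx : x ≤ 0) (hy : y ≤ 0) : 0 < P.green x y := by
  rw [P.green_eq_density_add hx hy]
  exact add_pos_of_pos_of_nonneg (P.density_pos _) (tsum_nonneg fun n => P.killedDensity_nonneg _ _ _)

/-! ### Bounds of the Green function near the origin -/

/-- Gaussian decay of the part of the Green function that comes from at least two steps. -/
theorem exists_green_le : ∃ c : ℝ, 1 < c ∧ ∀ x y : ℝ, x ≤ 0 → y ≤ 0 → P.green x y ≤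
    P.density 0 + Real.exp (-(y ^ 2 / (2 * c))) * (P.green 0 0 - P.density 0) := by
  obtain ⟨c, hc, h⟩ := P.exists_killedDensity_gaussian_decay
  refine ⟨c, hc, fun x y hx hy => ?_⟩
  rw [P.green_eq_density_add hx hy, P.green_eq_density_add (le_refl 0) (le_refl 0), sub_zero,
    add_sub_cancel_left, ← tsum_mul_left]
  refine add_le_add (P.density_le _) (Summable.tsum_le_tsum (fun n => h n x y hx hy)
    ((summable_nat_add_iff 1).2 (P.summable_killedDensity hx hy))
    (((summable_nat_add_iff 1).2 P.summable_killedDensity_origin).mul_left _))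

/-- The two-step term is positive. This strictness makes the constant of the quadratic bound
positive. -/
theorem density_zero_lt_green : P.density 0 < P.green 0 0 := by
  rw [P.green_eq_density_add (le_refl 0) (le_refl 0), sub_zero, lt_add_iff_pos_right]
  refine ((summable_nat_add_iff 1).2 P.summable_killedDensity_origin).tsum_pos
    (fun n => P.killedDensity_nonneg _ _ _) 0 ?_
  rw [killedDensity_succ, setIntegral_pos_iff_support_of_nonneg_ae
    (Eventually.of_forall fun z => mul_nonneg (P.density_pos _).le (P.killedDensity_nonneg _ _ _))
    (P.integrable_density_mul_killedDensity 0 0 0).integrableOn]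
  have : (Function.support fun z => P.density (z - 0) * P.killedDensity 0 z 0) = univ := by
    ext z
    simpa [killedDensity_zero] using ⟨(P.density_pos _).ne', (P.density_pos _).ne'⟩
  rw [this, univ_inter]
  simp

/-- The sum of the densities from the second step on is Lipschitz from below at the origin as a
function of the starting point. -/
theorem exists_tail_lower_bound : ∃ C : ℝ, 0 < C ∧ ∀ x y : ℝ, x ≤ 0 → -1 ≤ x → y ≤ 0 →
    ∑' n, P.killedDensity (n + 1) 0 y - C * (-x) ≤ ∑' n, P.killedDensity (n + 1) x y := by
  obtain ⟨c, hc, -, h⟩ := P.exists_density_bounds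
  obtain ⟨K, hK, hK'⟩ := P.exists_sum_killedDensity_le
  have hc0 : 0 < c := by linarith
  set I := ∫ z in Ioi 0, (z + 1) * P.density z with hI
  have hI0 : 0 ≤ I := setIntegral_nonneg measurableSet_Ioi fun z hz =>
    mul_nonneg (by linarith [mem_Ioi.1 hz]) (P.density_pos z).le
  refine ⟨c * (K * I) + 1, by positivity, fun x y hx hx1 hy => ?_⟩
  have hs : ∀ {x : ℝ}, x ≤ 0 → Summable fun n => P.killedDensity (n + 1) x y := fun hx =>
    (summable_nat_add_iff 1).2 (P.summable_killedDensity hx hy)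
  -- The comparison is made for partial sums, where sum and integral commute freely, with a constant
  -- independent of `N`.
  have step : ∀ N, ∑ n ∈ Finset.range N, P.killedDensity (n + 1) 0 y -
      (c * (K * I)) * (-x) ≤ ∑ n ∈ Finset.range N, P.killedDensity (n + 1) x y := by
    intro N
    have hi : ∀ x, IntegrableOn (fun z => P.density (z - x) *
        ∑ n ∈ Finset.range N, P.killedDensity n z y) (Ioi 0) := by
      intro x
      simp only [Finset.mul_sum]
      exact integrable_finsetSum _ fun n _ =>
        (P.integrable_density_mul_killedDensity n x y).integrableOn
    have hsum : ∀ x, ∑ n ∈ Finset.range N, P.killedDensity (n + 1) x y =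
        ∫ z in Ioi 0, P.density (z - x) * ∑ n ∈ Finset.range N, P.killedDensity n z y := by
      intro x
      simp only [killedDensity_succ, Finset.mul_sum]
      exact (integral_finsetSum _ fun n _ =>
        (P.integrable_density_mul_killedDensity n x y).integrableOn).symm
    have hw : IntegrableOn (fun z => c * (-x) * K * ((z + 1) * P.density z)) (Ioi 0) :=
      P.integrableOn_weight_mul_density.const_mul _
    have e : (c * (K * I)) * (-x) = ∫ z in Ioi 0, c * (-x) * K * ((z + 1) * P.density z) := by
      rw [integral_const_mul, ← hI]; ring
    rw [hsum, hsum, e, ← integral_sub (hi 0) hw]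
    refine setIntegral_mono_on ((hi 0).sub hw) (hi x) measurableSet_Ioi fun z hz => ?_
    have hz0 : 0 < z := hz
    set G := ∑ n ∈ Finset.range N, P.killedDensity n z y with hG
    have hG0 : 0 ≤ G := Finset.sum_nonneg fun n _ => P.killedDensity_nonneg _ _ _
    have hGK : G ≤ K := by
      -- By symmetry the end point `y ≤ 0` may be replaced by `0`, which gives a bound uniform in
      -- `z` and `y`.
      refine le_trans (Finset.sum_le_sum fun n _ => ?_) (hK' N z hz0.le)
      rw [P.killedDensity_comm n z y, P.killedDensity_comm n z 0]
      exact P.killedDensity_le_origin_left n hy hz0.le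
    have h1 := h z x hz0.le hx
    have hρ := P.density_pos z
    have h2 : c * (z - x) * (-x) ≤ c * (-x) * (z + 1) := by
      have : 0 ≤ c * (-x) := mul_nonneg hc0.le (by linarith)
      nlinarith
    have h3 : P.density z - c * (-x) * (z + 1) * P.density z ≤ P.density (z - x) := by nlinarith
    have h4 := mul_le_mul_of_nonneg_right h3 hG0
    have h5 : 0 ≤ c * (-x) * (z + 1) * P.density z :=
      mul_nonneg (mul_nonneg (mul_nonneg hc0.le (by linarith)) (by linarith)) hρ.le
    have h6 := mul_le_mul_of_nonneg_left hGK h5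
    rw [sub_zero]
    nlinarith
  have lim := le_of_tendsto_of_tendsto' ((hs le_rfl).hasSum.tendsto_sum_nat.sub_const _)
    (hs hx).hasSum.tendsto_sum_nat step
  nlinarith

/-- In the terms with at least two steps, `x` and then, by symmetry, `y` are moved to `0`, each at
cost `C a`. The one-step term loses at most `c (y - x)² * P.density 0`, and `(y - x)² ≤ a² ≤ a`. -/
theorem exists_le_green : ∃ C : ℝ, 0 < C ∧ ∀ a x y : ℝ, a ≤ 1 → -a ≤ x → x ≤ 0 → -a ≤ y →
    y ≤ 0 → P.green 0 0 - C * a ≤ P.green x y := by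
  obtain ⟨C, hC, h⟩ := P.exists_tail_lower_bound
  obtain ⟨c, hc, -, hd⟩ := P.exists_density_bounds
  have hρ := P.density_pos 0
  refine ⟨2 * C + c * P.density 0, by positivity, fun a x y ha hax hx hay hy => ?_⟩
  rw [P.green_eq_density_add hx hy, P.green_eq_density_add (le_refl 0) (le_refl 0)]
  have h1 := h x y hx (by linarith) hy
  have h2 := h y 0 hy (by linarith) le_rfl
  simp only [P.killedDensity_comm _ y 0] at h2
  have h3 : (1 - c * a) * P.density 0 ≤ P.density (y - x) := by
    have h4 := hd 0 (-|y - x|) le_rfl (by simp)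
    have h5 : P.density (0 - -|y - x|) = P.density (y - x) := by
      rw [zero_sub, neg_neg]
      rcases abs_choice (y - x) with h | h <;> rw [h]
      exact P.density_neg _
    rw [h5] at h4
    refine le_trans (mul_le_mul_of_nonneg_right ?_ hρ.le) h4
    have h6 : |y - x| ≤ a := abs_le.2 ⟨by linarith, by linarith⟩
    have h7 : |y - x| * |y - x| ≤ a := by nlinarith [abs_nonneg (y - x)]
    have := mul_le_mul_of_nonneg_left h7 (by linarith : (0 : ℝ) ≤ c)
    linarith
  have h8 := mul_le_mul_of_nonneg_left (by linarith : -x ≤ a) hC.le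
  have h9 := mul_le_mul_of_nonneg_left (by linarith : -y ≤ a) hC.le
  rw [sub_zero]
  linarith

/-! ### The excursion densities of the walk -/

/-- Independence of the increment `ξ n` from the first `n` increments, as an integral formula. -/
theorem integral_increment (n : ℕ) {H : (ℕ → ℝ) × ℝ → ℝ} (hH : Measurable H) {C : ℝ}
    (hC : ∀ p, |H p| ≤ C)
    (hdep : ∀ ξ t, H (fun i => if i < n then ξ i else 0, t) = H (ξ, t)) :
    ∫ ξ, H (ξ, ξ n) ∂P.incrementLaw = ∫ ξ, ∫ t, H (ξ, t) ∂P.stepLaw ∂P.incrementLaw := by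
  have hind : ProbabilityTheory.iIndepFun (fun (i : ℕ) (ξ : ℕ → ℝ) => ξ i) P.incrementLaw :=
    ProbabilityTheory.iIndepFun_infinitePi (P := fun _ : ℕ => P.stepLaw) (X := fun _ t => t)
      (fun _ => measurable_id)
  have h2 := hind.indepFun_finset (Finset.range n) {n} (by simp) (fun i => measurable_pi_apply i)
  have hext : Measurable fun (η : Finset.range n → ℝ) (i : ℕ) =>
      if h : i ∈ Finset.range n then η ⟨i, h⟩ else 0 := by
    refine measurable_pi_lambda _ fun i => ?_
    by_cases h : i ∈ Finset.range n
    · simp only [h, dite_true]; fun_prop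
    · simp only [h, dite_false]; fun_prop
  have h3 : ProbabilityTheory.IndepFun (fun (ξ : ℕ → ℝ) (i : ℕ) => if i < n then ξ i else 0)
      (fun ξ : ℕ → ℝ => ξ n) P.incrementLaw := by
    have := h2.comp hext (measurable_pi_apply (⟨n, by simp⟩ : ({n} : Finset ℕ)))
    convert this using 1
    · ext ξ i
      simp [Function.comp]
    · rfl
  have htr : Measurable fun (ξ : ℕ → ℝ) (i : ℕ) => if i < n then ξ i else 0 := by
    refine measurable_pi_lambda _ fun i => ?_
    by_cases h : i < n
    · simp only [h, if_true]; fun_prop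
    · simp only [h, if_false]; fun_prop
  have h4 := (ProbabilityTheory.indepFun_iff_map_prod_eq_prod_map_map
    htr.aemeasurable (Measurable.aemeasurable (by fun_prop))).1 h3
  rw [show P.incrementLaw.map (fun ξ : ℕ → ℝ => ξ n) = P.stepLaw from
    Measure.infinitePi_map_eval (fun _ : ℕ => P.stepLaw) n] at h4
  have : IsProbabilityMeasure (P.incrementLaw.map fun (ξ : ℕ → ℝ) (i : ℕ) =>
    if i < n then ξ i else 0) := Measure.isProbabilityMeasure_map htr.aemeasurable
  have hint : Integrable H ((P.incrementLaw.map fun (ξ : ℕ → ℝ) (i : ℕ) =>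
      if i < n then ξ i else 0).prod P.stepLaw) :=
    (integrable_const C).mono' hH.aestronglyMeasurable (Eventually.of_forall hC)
  calc ∫ ξ, H (ξ, ξ n) ∂P.incrementLaw
      = ∫ ξ, H (fun i => if i < n then ξ i else 0, ξ n) ∂P.incrementLaw := by simp only [hdep]
    _ = ∫ p, H p ∂((P.incrementLaw.map fun (ξ : ℕ → ℝ) (i : ℕ) =>
      if i < n then ξ i else 0).prod P.stepLaw) := by
        rw [← h4, integral_map (htr.prodMk (by fun_prop)).aemeasurable hH.aestronglyMeasurable]
    _ = ∫ η, ∫ t, H (η, t) ∂P.stepLaw ∂(P.incrementLaw.map fun (ξ : ℕ → ℝ) (i : ℕ) =>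
      if i < n then ξ i else 0) := integral_prod _ hint
    _ = _ := by
        rw [integral_map htr.aemeasurable
          (hH.stronglyMeasurable.integral_prod_right' (ν := P.stepLaw)).aestronglyMeasurable]
        simp only [hdep]

theorem integral_stepLaw (φ : ℝ → ℝ) : ∫ t, φ t ∂P.stepLaw = ∫ t, P.density t * φ t := by
  rw [stepLaw, integral_withDensity_eq_integral_toReal_smul
    P.measurable_density.ennreal_ofReal (Eventually.of_forall fun _ => ENNReal.ofReal_lt_top)]
  simp only [smul_eq_mul, ENNReal.toReal_ofReal (P.density_pos _).le]

/-- The last step of the walk that has to stay above `a`. -/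
theorem setIntegral_walk_succ (a x : ℝ) (n : ℕ) {φ : ℝ → ℝ} (hφ : Measurable φ) {C : ℝ}
    (hC : ∀ z, |φ z| ≤ C) :
    ∫ ξ in {ξ : ℕ → ℝ | ∀ k, 1 ≤ k → k < n + 1 + 1 → a < walk x ξ k},
        φ (walk x ξ (n + 1)) ∂P.incrementLaw =
      ∫ ξ in {ξ : ℕ → ℝ | ∀ k, 1 ≤ k → k < n + 1 → a < walk x ξ k},
        (∫ z in Ioi a, P.density (z - walk x ξ n) * φ z) ∂P.incrementLaw := by
  set S : Set (ℕ → ℝ) := {ξ | ∀ k, 1 ≤ k → k < n + 1 → a < walk x ξ k} with hS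
  have hSm : MeasurableSet S := measurableSet_stay a x n
  set ψ : ℝ → ℝ := (Ioi a).indicator φ with hψ
  have hψm : Measurable ψ := hφ.indicator measurableSet_Ioi
  -- The indicator carries the constraints up to time `n`; the constraint at time `n + 1` is built
  -- into `ψ`.
  let H : (ℕ → ℝ) × ℝ → ℝ := fun p => S.indicator (fun _ => (1 : ℝ)) p.1 * ψ (walk x p.1 n + p.2)
  have hH : Measurable H := ((measurable_const.indicator hSm).comp measurable_fst).mul
    (hψm.comp (((measurable_walk x n).comp measurable_fst).add measurable_snd))
  have hC0 : 0 ≤ C := (abs_nonneg _).trans (hC 0)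
  have hψC : ∀ z, |ψ z| ≤ C := by
    intro z
    by_cases hz : z ∈ Ioi a
    · simpa [hψ, hz] using hC z
    · simpa [hψ, hz] using hC0
  have hHC : ∀ p, |H p| ≤ C := by
    intro p
    by_cases hp : p.1 ∈ S
    · simpa [H, hp] using hψC _
    · simpa [H, hp] using hC0
  have hw : ∀ (ξ : ℕ → ℝ) (k), k ≤ n → walk x (fun i => if i < n then ξ i else 0) k = walk x ξ k := by
    intro ξ k hk
    simp only [walk]
    congr 1
    refine Finset.sum_congr rfl fun i hi => ?_
    rw [if_pos (by have := Finset.mem_range.1 hi; omega)]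
  have hdep : ∀ ξ t, H (fun i => if i < n then ξ i else 0, t) = H (ξ, t) := by
    intro ξ t
    have : (fun i => if i < n then ξ i else 0) ∈ S ↔ ξ ∈ S :=
      forall_congr' fun k => forall_congr' fun _ => forall_congr' fun hk => by
        rw [hw ξ k (by omega)]
    simp only [H, hw ξ n le_rfl, indicator_apply, this]
  have hkey := P.integral_increment n hH hHC hdep
  have hws : ∀ ξ : ℕ → ℝ, walk x ξ (n + 1) = walk x ξ n + ξ n := fun ξ => by
    simp [walk, Finset.sum_range_succ, add_assoc]
  rw [← integral_indicator (measurableSet_stay a x (n + 1)), ← integral_indicator hSm]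
  convert hkey using 1
  · refine integral_congr_ae (Eventually.of_forall fun ξ => ?_)
    have hiff : (∀ k, 1 ≤ k → k < n + 1 + 1 → a < walk x ξ k) ↔
        ξ ∈ S ∧ walk x ξ (n + 1) ∈ Ioi a := by
      constructor
      · exact fun h => ⟨fun k h1 h2 => h k h1 (by omega), h (n + 1) (by omega) (by omega)⟩
      · rintro ⟨h1, h2⟩ k hk hk'
        rcases Nat.lt_succ_iff_lt_or_eq.1 hk' with h | rfl
        · exact h1 k hk h
        · exact h2
    simp only [H, hψ, ← hws, indicator_apply, mem_ofPred_eq, hiff]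
    by_cases h1 : ξ ∈ S <;> by_cases h2 : walk x ξ (n + 1) ∈ Ioi a <;> simp [h1, h2]
  · refine integral_congr_ae (Eventually.of_forall fun ξ => ?_)
    simp only [H, integral_const_mul]
    have e : ∫ t, ψ (walk x ξ n + t) ∂P.stepLaw =
        ∫ z in Ioi a, P.density (z - walk x ξ n) * φ z := by
      rw [P.integral_stepLaw, ← integral_indicator measurableSet_Ioi,
        ← integral_sub_right_eq_self (fun t => P.density t * ψ (walk x ξ n + t)) (walk x ξ n)]
      congr 1; ext z
      by_cases hz : z ∈ Ioi a <;> simp [hψ, hz]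
    rw [e]
    by_cases h1 : ξ ∈ S <;> simp [h1]

/-- The Markov property: `n` steps of the walk that has to stay above `a`, followed by a killed
walk from the position reached. -/
theorem setIntegral_walk_killedDensity (a x y : ℝ) (n m : ℕ) :
    ∫ ξ in {ξ : ℕ → ℝ | ∀ k, 1 ≤ k → k < n + 1 → a < walk x ξ k},
      P.killedDensity m (walk x ξ n - a) (y - a) ∂P.incrementLaw =
    P.killedDensity (n + m) (x - a) (y - a) := by
  induction n generalizing m with
  | zero =>
    have h : {ξ : ℕ → ℝ | ∀ k, 1 ≤ k → k < 0 + 1 → a < walk x ξ k} = univ := by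
      ext ξ
      simp only [mem_ofPred_eq, mem_univ, iff_true]
      intro k h1 h2; omega
    rw [h]
    simp [walk]
  | succ n ih =>
    rw [P.setIntegral_walk_succ a x n (φ := fun z => P.killedDensity m (z - a) (y - a))
      ((P.measurable_killedDensity_left m (y - a)).comp (by fun_prop))
      (C := P.density 0) (fun z => P.abs_killedDensity_le m _ _)]
    -- The last constrained step is handed over to the killed walk, which then makes one more step.
    rw [show n + 1 + m = n + (m + 1) by omega, ← ih (m + 1)]
    refine integral_congr_ae (Eventually.of_forall fun ξ => ?_)
    simp only
    rw [killedDensity_succ]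
    symm
    rw [← integral_indicator measurableSet_Ioi, ← integral_indicator measurableSet_Ioi,
      ← integral_sub_right_eq_self _ a]
    refine integral_congr_ae (Eventually.of_forall fun z => ?_)
    by_cases hz : a < z <;> simp [hz]

theorem excursionDensity_eq_killedDensity (a : ℝ) (n : ℕ) (x y : ℝ) :
    P.excursionDensity a (n + 1) x y = P.killedDensity n (x - a) (y - a) := by
  rw [excursionDensity_succ]
  have := P.setIntegral_walk_killedDensity a x y n 0
  simpa [killedDensity_zero] using this

theorem resolventKernel_zero (a x y : ℝ) :
    P.resolventKernel a 0 x y = P.green (x - a) (y - a) := by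
  simp [resolventKernel, green, excursionDensity_eq_killedDensity]

theorem criticalValue_eq : P.criticalValue = -Real.log (P.green 0 0) := by
  simp [criticalValue, green, excursionDensity_eq_killedDensity]

end WalkPotential

/-! ### Perron eigenfunctions of positive continuous kernels -/

namespace PositiveKernel

open BoundedContinuousFunction

variable {X : Type*} [MetricSpace X] [CompactSpace X] [MeasurableSpace X] [BorelSpace X]

theorem integrable_of_continuous (μ : Measure X) [IsFiniteMeasure μ] {f : X → ℝ}
    (hf : Continuous f) : Integrable f μ :=
  (mkOfCompact ⟨f, hf⟩).integrable μ

/-- The integral operator with a continuous kernel on a compact space. -/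
def integralOperator (μ : Measure X) [IsFiniteMeasure μ] (k : C(X × X, ℝ)) (f : X →ᵇ ℝ) :
    X →ᵇ ℝ :=
  mkOfCompact ⟨fun x => ∫ y, k (x, y) * f y ∂μ, by
    refine continuous_of_dominated (bound := fun _ => ‖k‖ * ‖f‖) (fun x => ?_) (fun x => ?_)
      (integrable_const _) ?_
    · exact (Continuous.mul (by fun_prop) f.continuous).aestronglyMeasurable
    · refine Eventually.of_forall fun y => ?_
      rw [norm_mul]
      exact mul_le_mul (k.norm_coe_le_norm _) (f.norm_coe_le_norm _) (norm_nonneg _)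
        (norm_nonneg _)
    · exact Eventually.of_forall fun y => by fun_prop⟩

variable (μ : Measure X) [IsFiniteMeasure μ] (k : C(X × X, ℝ))

theorem integralOperator_apply (f : X →ᵇ ℝ) (x : X) :
    integralOperator μ k f x = ∫ y, k (x, y) * f y ∂μ := rfl

theorem integrable_kernel_mul (f : X →ᵇ ℝ) (x : X) : Integrable (fun y => k (x, y) * f y) μ :=
  integrable_of_continuous μ (Continuous.mul (by fun_prop) f.continuous)

theorem integralOperator_smul_add (c : ℝ) (f h : X →ᵇ ℝ) (x : X) :
    integralOperator μ k (c • f + h) x =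
      c * integralOperator μ k f x + integralOperator μ k h x := by
  simp only [integralOperator_apply]
  rw [← integral_const_mul, ← integral_add ((integrable_kernel_mul μ k f x).const_mul c)
    (integrable_kernel_mul μ k h x)]
  congr 1; ext y
  simp only [coe_add, coe_smul, Pi.add_apply, smul_eq_mul]
  ring

theorem continuous_integralOperator : Continuous (integralOperator μ k) := by
  refine LipschitzWith.continuous (K := (‖k‖ * μ.real univ).toNNReal)
    (LipschitzWith.of_dist_le_mul fun f h => ?_)
  rw [Real.coe_toNNReal _ (by positivity), BoundedContinuousFunction.dist_le (by positivity)]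
  intro x
  rw [Real.dist_eq, integralOperator_apply, integralOperator_apply,
    ← integral_sub (integrable_kernel_mul μ k f x) (integrable_kernel_mul μ k h x)]
  have := norm_integral_le_of_norm_le_const (μ := μ)
    (f := fun y => k (x, y) * f y - k (x, y) * h y) (C := ‖k‖ * dist f h)
    (Eventually.of_forall fun y => by
      rw [← mul_sub, norm_mul, ← dist_eq_norm]
      exact mul_le_mul (k.norm_coe_le_norm _) (dist_coe_le_dist y) dist_nonneg (norm_nonneg _))
  rw [Real.norm_eq_abs] at this
  linarith

variable {k} {m : ℝ}

theorem mul_integral_le_integralOperator (hm : ∀ p, m ≤ k p) {f : X →ᵇ ℝ} (hf : ∀ x, 0 ≤ f x)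
    (x : X) : m * ∫ y, f y ∂μ ≤ integralOperator μ k f x := by
  rw [← integral_const_mul]
  exact integral_mono ((f.integrable μ).const_mul m) (integrable_kernel_mul μ k f x)
    fun y => mul_le_mul_of_nonneg_right (hm _) (hf y)

theorem integralOperator_le_mul_integral {f : X →ᵇ ℝ} (hf : ∀ x, 0 ≤ f x) (x : X) :
    integralOperator μ k f x ≤ ‖k‖ * ∫ y, f y ∂μ := by
  rw [← integral_const_mul]
  exact integral_mono (integrable_kernel_mul μ k f x) ((f.integrable μ).const_mul _)
    fun y => mul_le_mul_of_nonneg_right ((le_abs_self _).trans (k.norm_coe_le_norm _)) (hf y)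

variable (k) in
/-- The image of the probability densities under the integral operator. -/
def simplexImage : Set (X →ᵇ ℝ) :=
  integralOperator μ k '' {h | (∀ x, 0 ≤ h x) ∧ ∫ y, h y ∂μ = 1}

theorem simplexImage_bounds (hm : ∀ p, m ≤ k p) {f : X →ᵇ ℝ} (hf : f ∈ simplexImage μ k) (x : X) :
    f x ∈ Icc m ‖k‖ := by
  obtain ⟨h, ⟨h0, h1⟩, rfl⟩ := hf
  constructor
  · simpa [h1] using mul_integral_le_integralOperator μ hm h0 x
  · simpa [h1] using integralOperator_le_mul_integral (k := k) μ h0 x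

/-- Arzelà–Ascoli: averaging `k (x, ·)` against a probability density preserves the modulus of
continuity of `k` in `x`. -/
theorem isCompact_closure_simplexImage (hm : ∀ p, m ≤ k p) :
    IsCompact (closure (simplexImage μ k)) := by
  refine arzela_ascoli (Icc m ‖k‖) isCompact_Icc _ (fun f x hf => simplexImage_bounds μ hm hf x) ?_
  intro x₀
  rw [Metric.equicontinuousAt_iff]
  intro ε hε
  obtain ⟨δ, hδ, h⟩ := Metric.uniformContinuous_iff.1
    (CompactSpace.uniformContinuous_of_continuous k.continuous) (ε / 2) (by positivity)
  refine ⟨δ, hδ, ?_⟩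
  rintro x hx ⟨_, f, ⟨f0, f1⟩, rfl⟩
  refine lt_of_le_of_lt ?_ (half_lt_self hε)
  simp only [integralOperator_apply]
  rw [Real.dist_eq,
    ← integral_sub (integrable_kernel_mul μ k f x₀) (integrable_kernel_mul μ k f x),
    ← Real.norm_eq_abs]
  refine (norm_integral_le_of_norm_le ((f.integrable μ).const_mul (ε / 2))
    (Eventually.of_forall fun y => ?_)).trans (by rw [integral_const_mul, f1, mul_one])
  rw [← sub_mul, norm_mul, ← dist_eq_norm, Real.norm_of_nonneg (f0 y)]
  refine mul_le_mul_of_nonneg_right (le_of_lt (h ?_)) (f0 y)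
  rwa [Prod.dist_eq, dist_self, max_eq_left dist_nonneg, dist_comm]

/-- The theorem of Jentzsch for continuous kernels: a strictly positive continuous kernel on a
compact space has a strictly positive continuous eigenfunction. -/
theorem exists_pos_eigenfunction [Nonempty X] (hμ : μ ≠ 0) (hk : ∀ p, 0 < k p) :
    ∃ (l : ℝ) (g : C(X, ℝ)), 0 < l ∧ (∀ x, 0 < g x) ∧
      ∀ x, ∫ y, k (x, y) * g y ∂μ = l * g x := by
  obtain ⟨p₀, -, hp₀⟩ := isCompact_univ.exists_isMinOn univ_nonempty k.continuous.continuousOn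
  set m := k p₀ with hm_def
  have hm : ∀ p, m ≤ k p := fun p => hp₀ (mem_univ p)
  have hm0 : 0 < m := hk p₀
  have hM0 : 0 < ‖k‖ := hm0.trans_le ((le_abs_self _).trans (k.norm_coe_le_norm p₀))
  have hμ0 : 0 < μ.real univ := by
    rw [measureReal_def, ENNReal.toReal_pos_iff]
    exact ⟨by simpa [pos_iff_ne_zero] using hμ, measure_lt_top _ _⟩
  set T := integralOperator μ k with hT
  set 𝒦 := closure (simplexImage μ k) with h𝒦
  have h𝒦c : IsCompact 𝒦 := isCompact_closure_simplexImage μ hm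
  have hb : ∀ f ∈ 𝒦, ∀ x, f x ∈ Icc m ‖k‖ := by
    intro f hf x
    have : IsClosed {f : X →ᵇ ℝ | f x ∈ Icc m ‖k‖} :=
      isClosed_Icc.preimage (continuous_eval_const (F := X →ᵇ ℝ) x)
    exact closure_minimal (fun f hf => simplexImage_bounds μ hm hf x) this hf
  have hint : ∀ f ∈ 𝒦, 0 < ∫ y, f y ∂μ := by
    intro f hf
    have : ∫ _, m ∂μ ≤ ∫ y, f y ∂μ :=
      integral_mono (integrable_const _) (f.integrable μ) fun y => (hb f hf y).1
    rw [integral_const, smul_eq_mul] at this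
    exact lt_of_lt_of_le (by positivity) this
  have hnorm : ∀ f : X →ᵇ ℝ, (∀ x, 0 ≤ f x) → 0 < ∫ y, f y ∂μ →
      T ((∫ y, f y ∂μ)⁻¹ • f) ∈ 𝒦 := by
    intro f f0 f1
    refine subset_closure ⟨_, ⟨fun x => ?_, ?_⟩, rfl⟩
    · exact mul_nonneg (inv_nonneg.2 f1.le) (f0 x)
    · simp only [coe_smul, smul_eq_mul]
      rw [integral_const_mul, inv_mul_cancel₀ f1.ne']
  -- For `f` in `𝒦`, `t f ≤ T f` forces `t m ≤ ‖k‖ ∫ f ≤ ‖k‖² μ(X)`.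
  set b := ‖k‖ * (‖k‖ * μ.real univ) / m with hb_def
  have htb : ∀ (t : ℝ), ∀ f ∈ 𝒦, 0 ≤ t → (∀ x, t * f x ≤ T f x) → t ≤ b := by
    intro t f hf ht h
    obtain ⟨x⟩ := ‹Nonempty X›
    rw [hb_def, le_div_iff₀ hm0]
    have h1 : T f x ≤ ‖k‖ * ∫ y, f y ∂μ :=
      integralOperator_le_mul_integral μ (fun y => hm0.le.trans (hb f hf y).1) x
    have h2 : ∫ y, f y ∂μ ≤ ∫ _, ‖k‖ ∂μ :=
      integral_mono (f.integrable μ) (integrable_const _) fun y => (hb f hf y).2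
    rw [integral_const, smul_eq_mul] at h2
    have h3 := mul_le_mul_of_nonneg_left (hb f hf x).1 ht
    have h4 := mul_le_mul_of_nonneg_left h2 hM0.le
    have := h x
    linarith
  -- Collatz–Wielandt: the eigenvalue is the largest `t` admitting `t f ≤ T f` for some `f` in `𝒦`,
  -- attained by compactness.
  set Z : Set (ℝ × (X →ᵇ ℝ)) := (Icc 0 b ×ˢ 𝒦) ∩ {q | ∀ x, q.1 * q.2 x ≤ T q.2 x} with hZ
  have hZc : IsCompact Z := by
    refine (isCompact_Icc.prod h𝒦c).inter_right ?_
    rw [ofPred_forall]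
    refine isClosed_iInter fun x => ?_
    have ev : Continuous fun f : X →ᵇ ℝ => f x := continuous_eval_const x
    exact isClosed_le (continuous_fst.mul (ev.comp continuous_snd))
      (ev.comp ((continuous_integralOperator μ k).comp continuous_snd))
  have hZn : Z.Nonempty := by
    have h1 : (0 : ℝ) < ∫ y, (BoundedContinuousFunction.const X (1 : ℝ)) y ∂μ := by
      simpa using hμ0
    have h2 := hnorm (BoundedContinuousFunction.const X 1) (fun x => by simp) h1
    refine ⟨(0, _), ⟨⟨le_rfl, by positivity⟩, h2⟩, fun x => ?_⟩
    simp only [zero_mul]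
    exact (mul_nonneg hm0.le (hint _ h2).le).trans
      (mul_integral_le_integralOperator μ hm (fun y => hm0.le.trans (hb _ h2 y).1) x)
  obtain ⟨⟨l, g⟩, ⟨⟨⟨hl0, hlb⟩, hg⟩, hlg⟩, hmax⟩ :=
    hZc.exists_isMaxOn hZn continuous_fst.continuousOn
  simp only [mem_ofPred_eq] at hlg
  have hg0 : ∀ x, 0 ≤ g x := fun x => hm0.le.trans (hb g hg x).1
  have hN := hint g hg
  set N := ∫ y, g y ∂μ with hN_def
  have hTg : ∀ x, m * N ≤ T g x := mul_integral_le_integralOperator μ hm hg0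
  set d : X →ᵇ ℝ := T g - l • g with hd
  have hd0 : ∀ x, 0 ≤ d x := fun x => sub_nonneg.2 (hlg x)
  have hdT : ∀ x, T (T g) x = l * T g x + T d x := by
    intro x
    rw [hT, ← integralOperator_smul_add, ← hT]
    congr 2
    rw [hd]; abel
  have hD0 : 0 ≤ ∫ y, d y ∂μ := integral_nonneg hd0
  rcases hD0.eq_or_lt with hD | hD
  -- The defect `d` vanishes only almost everywhere, so `g` need not satisfy the equation at every
  -- point; but `T d = 0` everywhere, hence `T g` does.
  · have hae : d =ᵐ[μ] 0 := (integral_eq_zero_iff_of_nonneg hd0 (d.integrable μ)).1 hD.symm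
    have hTd : ∀ x, T d x = 0 := by
      intro x
      rw [hT, integralOperator_apply, integral_eq_zero_of_ae]
      filter_upwards [hae] with y hy
      simp [hy]
    have heig : ∀ x, T (T g) x = l * T g x := fun x => by rw [hdT, hTd, add_zero]
    have hTg0 : ∀ x, 0 < T g x := fun x => lt_of_lt_of_le (by positivity) (hTg x)
    have hl : 0 < l := by
      obtain ⟨x⟩ := ‹Nonempty X›
      have h1 : m * ∫ y, T g y ∂μ ≤ T (T g) x :=
        mul_integral_le_integralOperator μ hm (fun y => (hTg0 y).le) x
      have h2 : ∫ _, m * N ∂μ ≤ ∫ y, T g y ∂μ :=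
        integral_mono (integrable_const _) ((T g).integrable μ) hTg
      rw [integral_const, smul_eq_mul] at h2
      have h3 : 0 < ∫ y, T g y ∂μ := lt_of_lt_of_le (by positivity) h2
      rw [heig] at h1
      exact pos_of_mul_pos_left (lt_of_lt_of_le (by positivity) h1) (hTg0 x).le
    exact ⟨l, (T g).toContinuousMap, hl, hTg0, heig⟩
  -- If `d` has positive mass, then `T d ≥ m D > 0` everywhere, and the normalised image of `g`
  -- admits `l + s`, against maximality. The choice of `s` makes `s ‖k‖ = m D / N`.
  · exfalso
    set D := ∫ y, d y ∂μ
    have hf := hnorm g hg0 hN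
    rw [← hN_def] at hf
    have e1 : ∀ f : X →ᵇ ℝ, ∀ x, T (N⁻¹ • f) x = N⁻¹ * T f x := by
      intro f x
      have h0 : T 0 x = 0 := by rw [hT, integralOperator_apply]; simp
      have := integralOperator_smul_add μ k N⁻¹ f 0 x
      rw [add_zero, ← hT, h0, add_zero] at this
      exact this
    have e2 : T (N⁻¹ • g) = N⁻¹ • T g := by
      ext x; rw [e1]; rfl
    set s := m * D / (N * ‖k‖) with hs
    have hs0 : 0 < s := by positivity
    have hbig : ∀ x, (l + s) * T (N⁻¹ • g) x ≤ T (T (N⁻¹ • g)) x := by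
      intro x
      have h1 : m * D ≤ T d x := mul_integral_le_integralOperator μ hm hd0 x
      have h2 := (hb _ hf x).2
      have h3 : s * T (N⁻¹ • g) x ≤ N⁻¹ * (m * D) := by
        calc _ ≤ s * ‖k‖ := mul_le_mul_of_nonneg_left h2 hs0.le
          _ = _ := by rw [hs]; field_simp
      have h4 : T (T (N⁻¹ • g)) x = l * T (N⁻¹ • g) x + N⁻¹ * T d x := by
        rw [e2, e1, hdT]
        simp only [coe_smul, smul_eq_mul]; ring
      rw [h4, add_mul]
      exact add_le_add_right (h3.trans (mul_le_mul_of_nonneg_left h1 (inv_nonneg.2 hN.le))) _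
    have hls : l + s ≤ b := htb _ _ hf (by positivity) hbig
    have := hmax (show (l + s, T (N⁻¹ • g)) ∈ Z from ⟨⟨⟨by positivity, hls⟩, hf⟩, hbig⟩)
    simp only [mem_ofPred_eq] at this
    linarith

end PositiveKernel

/-! ### Perron eigenvalues of symmetric kernels on an interval -/

theorem ContinuousOn.kernel_right {K : ℝ → ℝ → ℝ} {s : Set ℝ}
    (hK : ContinuousOn (fun p : ℝ × ℝ => K p.1 p.2) (s ×ˢ s)) {x : ℝ} (hx : x ∈ s) :
    ContinuousOn (K x) s :=
  hK.comp (f := fun y => (x, y)) (by fun_prop) fun _ hy => ⟨hx, hy⟩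

theorem exists_isPerronEigenfunction {K : ℝ → ℝ → ℝ} {a : ℝ} (ha : 0 < a)
    (hK : ContinuousOn (fun p : ℝ × ℝ => K p.1 p.2) (Icc 0 a ×ˢ Icc 0 a))
    (hpos : ∀ x ∈ Icc 0 a, ∀ y ∈ Icc 0 a, 0 < K x y) :
    ∃ (l : ℝ) (V : ℝ → ℝ), 0 < l ∧ IsPerronEigenfunction K a l V := by
  let μ : Measure (Icc 0 a) := Measure.comap Subtype.val volume
  have hμuniv : μ univ = ENNReal.ofReal a := by
    rw [comap_subtype_coe_apply measurableSet_Icc, image_univ, Subtype.range_coe]; simp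
  have : IsFiniteMeasure μ := ⟨by rw [hμuniv]; exact ENNReal.ofReal_lt_top⟩
  have hμ : μ ≠ 0 := by
    intro h
    rw [h] at hμuniv
    simp at hμuniv
    linarith
  have : Nonempty (Icc 0 a) := ⟨⟨0, le_rfl, ha.le⟩⟩
  let k : C(Icc 0 a × Icc 0 a, ℝ) := ⟨fun p => K p.1 p.2,
    hK.comp_continuous (f := fun p : Icc 0 a × Icc 0 a => ((p.1 : ℝ), (p.2 : ℝ))) (by fun_prop)
      fun p => ⟨p.1.2, p.2.2⟩⟩
  obtain ⟨l, g, hl, hg, h⟩ := PositiveKernel.exists_pos_eigenfunction μ (k := k) hμ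
    fun p => hpos _ p.1.2 _ p.2.2
  have hext : ∀ y : Icc 0 a, IccExtend ha.le g y = g y := fun y => IccExtend_val ha.le g y
  refine ⟨l, IccExtend ha.le g, hl, (g.continuous.Icc_extend' ).continuousOn,
    fun x hx => ?_, fun x hx => ?_⟩
  · rw [IccExtend_of_mem ha.le g hx]; exact hg _
  · rw [← integral_subtype_comap measurableSet_Icc, IccExtend_of_mem ha.le g hx, ← h]
    simp only [hext]
    rfl

theorem ContinuousOn.memLp_restrict_of_isCompact {E : Type*} [TopologicalSpace E]
    [SecondCountableTopology E] [T2Space E] [MeasurableSpace E] [BorelSpace E] {μ : Measure E}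
    [IsFiniteMeasureOnCompacts μ] {f : E → ℝ} {s : Set E} (hf : ContinuousOn f s)
    (hs : IsCompact s) (hsm : MeasurableSet s) (p : ENNReal) : MemLp f p (μ.restrict s) := by
  obtain ⟨C, hC⟩ := hs.exists_bound_of_continuousOn hf
  have : IsFiniteMeasure (μ.restrict s) := ⟨by simpa using hs.measure_lt_top⟩
  refine MemLp.of_bound (hf.aestronglyMeasurable hsm) C ?_
  filter_upwards [ae_restrict_mem hsm] with x hx using hC x hx

/-- A Perron eigenvalue of a symmetric kernel is its largest eigenvalue. -/
theorem isGreatest_of_isPerronEigenfunction {K : ℝ → ℝ → ℝ} {a l : ℝ} {V : ℝ → ℝ} (ha : 0 < a)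
    (hK : ContinuousOn (fun p : ℝ × ℝ => K p.1 p.2) (Icc 0 a ×ˢ Icc 0 a))
    (hpos : ∀ x ∈ Icc 0 a, ∀ y ∈ Icc 0 a, 0 < K x y)
    (hsymm : ∀ x ∈ Icc 0 a, ∀ y ∈ Icc 0 a, K x y = K y x)
    (hV : IsPerronEigenfunction K a l V) : IsGreatest {μ | IsKernelEigenvalue K a μ} l := by
  obtain ⟨hVc, hV0, hVl⟩ := hV
  set ν : Measure ℝ := volume.restrict (Icc 0 a) with hν
  have hmem : ∀ᵐ x ∂ν, x ∈ Icc 0 a := ae_restrict_mem measurableSet_Icc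
  constructor
  · refine ⟨V, ?_, ?_, ?_⟩
    · exact hVc.memLp_restrict_of_isCompact isCompact_Icc measurableSet_Icc 2
    · intro h
      have h1 : ∀ᵐ x ∂ν, False := by
        filter_upwards [h, hmem] with x hx hx'
        exact (hV0 x hx').ne' hx
      rw [Filter.eventually_false_iff_eq_bot, ae_eq_bot] at h1
      have h2 : ν univ = ENNReal.ofReal a := by simp [hν]
      rw [h1] at h2
      simp at h2
      linarith
    · filter_upwards [hmem] with x hx using hVl x hx
  · rintro μ ⟨v, hv2, hv0, hv⟩
    have hvi : Integrable v ν := hv2.integrable (by norm_num)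
    have hVi : Integrable V ν := hVc.integrableOn_compact isCompact_Icc
    obtain ⟨M, hM⟩ := isCompact_Icc.exists_bound_of_continuousOn hVc
    have hp : Integrable (fun p : ℝ × ℝ => (V p.1 * K p.1 p.2) * |v p.2|) (ν.prod ν) := by
      have hc : ContinuousOn (fun p : ℝ × ℝ => V p.1 * K p.1 p.2) (Icc 0 a ×ˢ Icc 0 a) :=
        (hVc.comp continuousOn_fst fun p hp => hp.1).mul hK
      obtain ⟨C, hC⟩ := (isCompact_Icc.prod isCompact_Icc).exists_bound_of_continuousOn hc
      have hprod : ν.prod ν = (volume.prod volume).restrict (Icc 0 a ×ˢ Icc 0 a) :=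
        Measure.prod_restrict _ _
      refine Integrable.bdd_mul (c := C) ((hvi.abs).comp_snd ν) ?_ ?_
      · rw [hprod]
        exact hc.aestronglyMeasurable (measurableSet_Icc.prod measurableSet_Icc)
      · rw [hprod]
        filter_upwards [ae_restrict_mem (measurableSet_Icc.prod measurableSet_Icc)] with p hp
          using hC p hp
    have hVv : Integrable (fun x => V x * |v x|) ν :=
      hvi.abs.bdd_mul (c := M) hVi.aestronglyMeasurable
        (by filter_upwards [hmem] with x hx using hM x hx)
    have hpos' : 0 < ∫ x, V x * |v x| ∂ν := by
      have hnn : 0 ≤ᵐ[ν] fun x => V x * |v x| := by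
        filter_upwards [hmem] with x hx using mul_nonneg (hV0 x hx).le (abs_nonneg _)
      refine lt_of_le_of_ne (integral_nonneg_of_ae hnn) fun h => hv0 ?_
      filter_upwards [(integral_eq_zero_iff_of_nonneg_ae hnn hVv).1 h.symm, hmem] with x hx hx'
      simpa [(hV0 x hx').ne'] using hx
    -- Test `|μ v| ≤ ∫ K |v|` against `V`; after exchanging the integrals, symmetry lets `K` act on
    -- `V` and produce `l`.
    have h1 : μ * ∫ x, V x * |v x| ∂ν ≤ ∫ x, ∫ y, (V x * K x y) * |v y| ∂ν ∂ν := by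
      rw [← integral_const_mul]
      refine integral_mono_ae (hVv.const_mul μ) hp.integral_prod_left ?_
      filter_upwards [hv, hmem] with x hx hx'
      calc μ * (V x * |v x|) ≤ V x * |μ * v x| := by
            rw [abs_mul]
            have := mul_le_mul_of_nonneg_right (le_abs_self μ)
              (mul_nonneg (hV0 x hx').le (abs_nonneg (v x)))
            linarith
        _ = V x * |∫ y, K x y * v y ∂ν| := by rw [hx]
        _ ≤ V x * ∫ y, K x y * |v y| ∂ν := by
            refine mul_le_mul_of_nonneg_left ?_ (hV0 x hx').le
            refine (abs_integral_le_integral_abs).trans (le_of_eq (integral_congr_ae ?_))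
            filter_upwards [hmem] with y hy
            rw [abs_mul, abs_of_pos (hpos x hx' y hy)]
        _ = _ := by
            rw [← integral_const_mul]
            simp only [mul_assoc]
    rw [integral_integral_swap hp] at h1
    have h2 : ∫ y, ∫ x, (V x * K x y) * |v y| ∂ν ∂ν = l * ∫ x, V x * |v x| ∂ν := by
      rw [← integral_const_mul]
      refine integral_congr_ae ?_
      filter_upwards [hmem] with y hy
      rw [integral_mul_const, ← mul_assoc, ← hVl y hy]
      congr 1
      refine integral_congr_ae ?_
      filter_upwards [hmem] with x hx
      rw [hsymm x hx y hy, mul_comm]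
    rw [h2] at h1
    exact le_of_mul_le_mul_right h1 hpos'

/-- A Perron eigenvalue lies between bounds of the row sums. -/
theorem IsPerronEigenfunction.le_of_row_sums_le {K : ℝ → ℝ → ℝ} {a l r : ℝ} {V : ℝ → ℝ}
    (ha : 0 < a) (hK : ContinuousOn (fun p : ℝ × ℝ => K p.1 p.2) (Icc 0 a ×ˢ Icc 0 a))
    (hpos : ∀ x ∈ Icc 0 a, ∀ y ∈ Icc 0 a, 0 < K x y) (hV : IsPerronEigenfunction K a l V)
    (hr : ∀ x ∈ Icc 0 a, ∫ y in Icc 0 a, K x y ≤ r) : l ≤ r := by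
  obtain ⟨hVc, hV0, hVl⟩ := hV
  -- The eigenvalue equation is read at a maximum point of `V`; the lower bound uses a minimum
  -- point.
  obtain ⟨x, hx, hmax⟩ := isCompact_Icc.exists_isMaxOn (nonempty_Icc.2 ha.le) hVc
  have hKx := hK.kernel_right hx
  have h1 : l * V x ≤ (∫ y in Icc 0 a, K x y) * V x := by
    rw [← hVl x hx, ← integral_mul_const]
    exact setIntegral_mono_on ((hKx.mul hVc).integrableOn_compact isCompact_Icc)
      ((hKx.integrableOn_compact isCompact_Icc).mul_const _) measurableSet_Icc fun y hy =>
        mul_le_mul_of_nonneg_left (hmax hy) (hpos x hx y hy).le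
  exact (le_of_mul_le_mul_right h1 (hV0 x hx)).trans (hr x hx)

theorem IsPerronEigenfunction.le_of_le_row_sums {K : ℝ → ℝ → ℝ} {a l r : ℝ} {V : ℝ → ℝ}
    (ha : 0 < a) (hK : ContinuousOn (fun p : ℝ × ℝ => K p.1 p.2) (Icc 0 a ×ˢ Icc 0 a))
    (hpos : ∀ x ∈ Icc 0 a, ∀ y ∈ Icc 0 a, 0 < K x y) (hV : IsPerronEigenfunction K a l V)
    (hr : ∀ x ∈ Icc 0 a, r ≤ ∫ y in Icc 0 a, K x y) : r ≤ l := by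
  obtain ⟨hVc, hV0, hVl⟩ := hV
  obtain ⟨x, hx, hmin⟩ := isCompact_Icc.exists_isMinOn (nonempty_Icc.2 ha.le) hVc
  have hKx := hK.kernel_right hx
  have h1 : (∫ y in Icc 0 a, K x y) * V x ≤ l * V x := by
    rw [← hVl x hx, ← integral_mul_const]
    exact setIntegral_mono_on ((hKx.integrableOn_compact isCompact_Icc).mul_const _)
      ((hKx.mul hVc).integrableOn_compact isCompact_Icc) measurableSet_Icc fun y hy =>
        mul_le_mul_of_nonneg_left (hmin hy) (hpos x hx y hy).le
  exact (hr x hx).trans (le_of_mul_le_mul_right h1 (hV0 x hx))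

/-! ### Asymptotics of the Perron eigenvalue and of the critical value. -/

namespace WalkPotential

variable (P : WalkPotential)

theorem sub_nonpos_of_mem {a x : ℝ} (hx : x ∈ Icc 0 a) : x - a ≤ 0 := sub_nonpos.2 hx.2

theorem resolventKernel_pos (a : ℝ) : ∀ x ∈ Icc 0 a, ∀ y ∈ Icc 0 a, 0 < P.resolventKernel a 0 x y :=
  fun x hx y hy => by
    rw [resolventKernel_zero]
    exact P.green_pos (sub_nonpos_of_mem hx) (sub_nonpos_of_mem hy)

theorem resolventKernel_comm (a x y : ℝ) :
    P.resolventKernel a 0 x y = P.resolventKernel a 0 y x := by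
  rw [resolventKernel_zero, resolventKernel_zero, green_comm]

theorem continuousOn_resolventKernel (a : ℝ) :
    ContinuousOn (fun p : ℝ × ℝ => P.resolventKernel a 0 p.1 p.2) (Icc 0 a ×ˢ Icc 0 a) := by
  simp only [resolventKernel_zero]
  exact P.continuousOn_green.comp (f := fun p : ℝ × ℝ => (p.1 - a, p.2 - a)) (by fun_prop)
    fun p hp => ⟨sub_nonpos_of_mem hp.1, sub_nonpos_of_mem hp.2⟩

theorem isGreatest_perronEigenvalue {a : ℝ} (ha : 0 < a) :
    IsGreatest {μ | IsKernelEigenvalue (P.resolventKernel a 0) a μ} (P.perronEigenvalue a 0) ∧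
      0 < P.perronEigenvalue a 0 ∧
      ∃ V : ℝ → ℝ, IsPerronEigenfunction (P.resolventKernel a 0) a (P.perronEigenvalue a 0) V := by
  obtain ⟨l, V, hl, hV⟩ := exists_isPerronEigenfunction ha (P.continuousOn_resolventKernel a)
    (P.resolventKernel_pos a)
  have h := isGreatest_of_isPerronEigenfunction ha (P.continuousOn_resolventKernel a)
    (P.resolventKernel_pos a) (fun x _ y _ => P.resolventKernel_comm a x y) hV
  have e : P.perronEigenvalue a 0 = l := h.csSup_eq
  rw [e]
  exact ⟨h, hl, V, hV⟩

/-- Since `e^u ≥ 1 + u` and `(1 + u) (1 - u / 2) ≥ 1` on `[0, 1]`. It linearises the Gaussian factor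
of the upper bound and yields the exponential form of the lower one. -/
theorem exp_neg_le_one_sub_half {u : ℝ} (h0 : 0 ≤ u) (h1 : u ≤ 1) : Real.exp (-u) ≤ 1 - u / 2 := by
  rw [Real.exp_neg, inv_le_comm₀ (Real.exp_pos _) (by linarith)]
  refine le_trans ?_ (Real.add_one_le_exp u)
  rw [inv_le_iff_one_le_mul₀ (by linarith)]
  nlinarith

/-- The kernel is at most `G - q (a - y)²`, so each row sum is at most `a G - q a³ / 3`: a relative
loss of order `a²`. -/
theorem exists_perronEigenvalue_le : ∃ D : ℝ, 0 < D ∧ ∀ a, 0 < a → a < 1 →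
    P.perronEigenvalue a 0 ≤ a * P.green 0 0 * Real.exp (-(D * a ^ 2)) := by
  obtain ⟨c, hc, h⟩ := P.exists_green_le
  have hc0 : 0 < c := by linarith
  have hρ := P.density_pos 0
  have hG := P.density_zero_lt_green
  set G := P.green 0 0
  set ρ := P.density 0
  have hG0 : 0 < G := hρ.trans hG
  -- With this `D`, `a G * D a² = q a³ / 8`, less than the available `q a³ / 3`.
  refine ⟨(G - ρ) / (32 * c * G), div_pos (by linarith) (by positivity), fun a ha ha1 => ?_⟩
  obtain ⟨-, -, V, hV⟩ := P.isGreatest_perronEigenvalue ha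
  set q := (G - ρ) / (4 * c) with hq
  have hq0 : 0 ≤ q := div_nonneg (by linarith) (by linarith)
  have hpt : ∀ x ∈ Icc 0 a, ∀ y ∈ Icc 0 a,
      P.resolventKernel a 0 x y ≤ G - q * (a - y) ^ 2 := by
    intro x hx y hy
    rw [resolventKernel_zero]
    refine (h _ _ (sub_nonpos_of_mem hx) (sub_nonpos_of_mem hy)).trans ?_
    have h1 : (y - a) ^ 2 / (2 * c) ≤ 1 := by
      rw [div_le_one (by linarith)]
      nlinarith [hy.1, hy.2]
    have h2 := exp_neg_le_one_sub_half (by positivity) h1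
    have h3 := mul_le_mul_of_nonneg_right h2 (by linarith : 0 ≤ G - ρ)
    have h4 : (1 - (y - a) ^ 2 / (2 * c) / 2) * (G - ρ) = (G - ρ) - q * (a - y) ^ 2 := by
      rw [hq]; field_simp; ring
    linarith
  have hint : ∫ y in Icc 0 a, (G - q * (a - y) ^ 2) = a * G - q * (a ^ 3 / 3) := by
    rw [integral_Icc_eq_integral_Ioc, ← intervalIntegral.integral_of_le ha.le,
      intervalIntegral.integral_sub (by simp) (Continuous.intervalIntegrable (by fun_prop) _ _),
      intervalIntegral.integral_const_mul,
      intervalIntegral.integral_comp_sub_left (fun t => t ^ 2) a, integral_pow,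
      intervalIntegral.integral_const, smul_eq_mul]
    push_cast
    ring
  have hrow := hV.le_of_row_sums_le ha (P.continuousOn_resolventKernel a) (P.resolventKernel_pos a)
    (r := a * G - q * (a ^ 3 / 3)) fun x hx => by
      rw [← hint]
      exact setIntegral_mono_on
        (((P.continuousOn_resolventKernel a).kernel_right hx).integrableOn_compact isCompact_Icc)
        (Continuous.integrableOn_Icc (by fun_prop)) measurableSet_Icc fun y hy => hpt x hx y hy
  refine hrow.trans ?_
  have h5 := Real.add_one_le_exp (-((G - ρ) / (32 * c * G) * a ^ 2))
  refine le_trans ?_ (mul_le_mul_of_nonneg_left h5 (by positivity))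
  have h6 : a * G * (-((G - ρ) / (32 * c * G) * a ^ 2) + 1) = a * G - q * (a ^ 3 / 8) := by
    rw [hq]; field_simp; ring
  rw [h6]
  have : 0 ≤ q * a ^ 3 := by positivity
  linarith

theorem exists_le_perronEigenvalue : ∃ C a₀ : ℝ, 0 < C ∧ 0 < a₀ ∧ ∀ a, 0 < a → a < a₀ →
    a * P.green 0 0 * Real.exp (-(C * a)) ≤ P.perronEigenvalue a 0 := by
  obtain ⟨C, hC, h⟩ := P.exists_le_green
  have hG0 : 0 < P.green 0 0 := (P.density_pos 0).trans P.density_zero_lt_green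
  set G := P.green 0 0
  -- With `u = 2 C a / G`, the bound `a (G - C a)` on the row sums equals `a G (1 - u / 2)`. The
  -- threshold ensures `a ≤ 1` and `u ≤ 1`.
  refine ⟨2 * C / G, min 1 (G / (2 * C)), by positivity, by positivity, fun a ha ha1 => ?_⟩
  have ha2 : a < 1 := ha1.trans_le (min_le_left _ _)
  have ha3 : a < G / (2 * C) := ha1.trans_le (min_le_right _ _)
  rw [lt_div_iff₀ (by positivity)] at ha3
  obtain ⟨-, -, V, hV⟩ := P.isGreatest_perronEigenvalue ha
  have hrow := hV.le_of_le_row_sums ha (P.continuousOn_resolventKernel a) (P.resolventKernel_pos a)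
    (r := a * (G - C * a)) fun x hx => by
      have e : ∫ _ in Icc 0 a, (G - C * a) = a * (G - C * a) := by
        simp [ha.le]
      rw [← e]
      refine setIntegral_mono_on (by simp)
        (((P.continuousOn_resolventKernel a).kernel_right hx).integrableOn_compact isCompact_Icc)
        measurableSet_Icc fun y hy => ?_
      rw [resolventKernel_zero]
      exact h a _ _ ha2.le (by linarith [hx.1]) (sub_nonpos_of_mem hx) (by linarith [hy.1])
        (sub_nonpos_of_mem hy)
  refine le_trans ?_ hrow
  have h1 : 2 * C / G * a ≤ 1 := by
    rw [div_mul_eq_mul_div, div_le_one hG0]; linarith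
  have h2 := exp_neg_le_one_sub_half (by positivity) h1
  calc _ ≤ a * G * (1 - 2 * C / G * a / 2) := mul_le_mul_of_nonneg_left h2 (by positivity)
    _ = _ := by field_simp

theorem exists_stripCriticalValue_bounds : ∃ C D a₀ : ℝ, 0 < C ∧ 0 < D ∧ 0 < a₀ ∧
    ∀ a : ℝ, 0 < a → a < a₀ →
      D * a ^ 2 ≤ Real.log a + P.stripCriticalValue a - P.criticalValue ∧
      Real.log a + P.stripCriticalValue a - P.criticalValue ≤ C * a := by
  obtain ⟨D, hD, hu⟩ := P.exists_perronEigenvalue_le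
  obtain ⟨C, a₀, hC, ha₀, hl⟩ := P.exists_le_perronEigenvalue
  have hG0 : 0 < P.green 0 0 := (P.density_pos 0).trans P.density_zero_lt_green
  refine ⟨C, D, min 1 a₀, hC, hD, by positivity, fun a ha ha1 => ?_⟩
  have hδ := (P.isGreatest_perronEigenvalue ha).2.1
  have hlog : ∀ t, Real.log (a * P.green 0 0 * Real.exp (-t)) =
      Real.log a + Real.log (P.green 0 0) - t := by
    intro t
    rw [Real.log_mul (by positivity) (Real.exp_pos _).ne', Real.log_mul ha.ne' hG0.ne',
      Real.log_exp, sub_eq_add_neg]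
  have h1 := Real.log_le_log hδ (hu a ha (ha1.trans_le (min_le_left _ _)))
  have h2 := Real.log_le_log (by positivity) (hl a ha (ha1.trans_le (min_le_right _ _)))
  rw [hlog] at h1 h2
  rw [stripCriticalValue, criticalValue_eq]
  constructor <;> linarith

end WalkPotential

end

theorem theorem3 (P : WalkPotential) :
    -- the quantities are well defined: the series of the two critical values converge, and
    -- `δ_a(0)` is the largest eigenvalue, is positive, and has a positive eigenfunction
    (Summable fun n : ℕ => P.excursionDensity 0 (n + 1) 0 0) ∧
    (∀ a : ℝ, 0 < a →
      (∀ x ∈ Icc 0 a, ∀ y ∈ Icc 0 a, Summable fun n : ℕ => P.excursionDensity a (n + 1) x y) ∧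
      MemLp (fun p : ℝ × ℝ => P.resolventKernel a 0 p.1 p.2) 2
        (volume.restrict (Icc 0 a ×ˢ Icc 0 a)) ∧
      IsGreatest {μ | IsKernelEigenvalue (P.resolventKernel a 0) a μ} (P.perronEigenvalue a 0) ∧
      0 < P.perronEigenvalue a 0 ∧
      ∃ V : ℝ → ℝ, IsPerronEigenfunction (P.resolventKernel a 0) a (P.perronEigenvalue a 0) V) ∧
    -- the two-sided estimate
    (∃ C D a₀ : ℝ, 0 < C ∧ 0 < D ∧ 0 < a₀ ∧ ∀ a : ℝ, 0 < a → a < a₀ →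
      D * a ^ 2 ≤ Real.log a + P.stripCriticalValue a - P.criticalValue ∧
      Real.log a + P.stripCriticalValue a - P.criticalValue ≤ C * a) ∧
    -- Condition (A) for the constant pinning functions, and the limit
    (∃ a₀ : ℝ, 0 < a₀ ∧ P.ConditionA a₀ fun a _ => P.stripCriticalValue a) ∧
    Tendsto (fun a : ℝ => a * Real.exp (P.stripCriticalValue a)) (𝓝[>] 0)
      (𝓝 (Real.exp P.criticalValue)) := by
  have hmain := P.exists_stripCriticalValue_bounds
  refine ⟨?_, fun a ha => ⟨fun x hx y hy => ?_, ?_, P.isGreatest_perronEigenvalue ha⟩, hmain,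
    ?_, ?_⟩
  · simpa [P.excursionDensity_eq_killedDensity] using P.summable_killedDensity_origin
  · simp only [P.excursionDensity_eq_killedDensity]
    exact P.summable_killedDensity (WalkPotential.sub_nonpos_of_mem hx)
      (WalkPotential.sub_nonpos_of_mem hy)
  · exact (P.continuousOn_resolventKernel a).memLp_restrict_of_isCompact
      (isCompact_Icc.prod isCompact_Icc) (measurableSet_Icc.prod measurableSet_Icc) 2
  · obtain ⟨C, D, a₀, hC, hD, ha₀, h⟩ := hmain
    refine ⟨a₀, ha₀, C, hC, fun a ha ha1 => ⟨by simp, ?_⟩⟩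
    obtain ⟨h1, h2⟩ := h a ha ha1
    -- The integrand is constant in `x`, so Condition (A) is the two-sided estimate divided by `a`;
    -- its lower half holds because the quantity is nonnegative.
    have e : Real.log (∫ _ in (0 : ℝ)..a, Real.exp (P.stripCriticalValue a - P.criticalValue)) =
        Real.log a + P.stripCriticalValue a - P.criticalValue := by
      rw [intervalIntegral.integral_const, sub_zero, smul_eq_mul,
        Real.log_mul ha.ne' (Real.exp_pos _).ne', Real.log_exp]
      ring
    simp only [e]
    have h3 : 0 ≤ D * a ^ 2 := by positivity
    constructor
    · have : 0 ≤ 1 / a * (Real.log a + P.stripCriticalValue a - P.criticalValue) :=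
        mul_nonneg (by positivity) (h3.trans h1)
      linarith
    · rw [one_div, inv_mul_le_iff₀ ha]
      linarith
  · obtain ⟨C, D, a₀, hC, hD, ha₀, h⟩ := hmain
    have h0 : Tendsto (fun a : ℝ => Real.log a + P.stripCriticalValue a - P.criticalValue)
        (𝓝[>] 0) (𝓝 0) := by
      have hev : ∀ᶠ a : ℝ in 𝓝[>] 0, a ∈ Ioo 0 a₀ := Ioo_mem_nhdsGT ha₀
      have t1 : Tendsto (fun a : ℝ => D * a ^ 2) (𝓝[>] 0) (𝓝 0) := by
        have : Continuous fun a : ℝ => D * a ^ 2 := by fun_prop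
        simpa using (this.continuousWithinAt (s := Ioi 0) (x := 0)).tendsto
      have t2 : Tendsto (fun a : ℝ => C * a) (𝓝[>] 0) (𝓝 0) := by
        have : Continuous fun a : ℝ => C * a := by fun_prop
        simpa using (this.continuousWithinAt (s := Ioi 0) (x := 0)).tendsto
      exact tendsto_of_tendsto_of_tendsto_of_le_of_le' t1 t2
        (hev.mono fun a ha => (h a ha.1 ha.2).1) (hev.mono fun a ha => (h a ha.1 ha.2).2)
    -- Exponentiating the squeezed quantity and multiplying by `e^{β_c}` gives `a e^{β_c(a)}`.
    have h1 := ((Real.continuous_exp.tendsto 0).comp h0).mul_const (Real.exp P.criticalValue)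
    rw [Real.exp_zero, one_mul] at h1
    refine h1.congr' ?_
    filter_upwards [self_mem_nhdsWithin] with a ha
    simp only [Function.comp]
    rw [← Real.exp_add, sub_add_cancel, Real.exp_add, Real.exp_log ha]
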